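/- **Conventions.** $\mathscr F$ is the category of full embeddings (fully faithful, injective-on-objects functors) $A_\tau\hookrightarrow A_\lambda$ of small categories, a morphism being a functor $A_\lambda\to B_\lambda$ that restricts to $A_\tau\to B_\tau$. An *$\mathscr F$-category* $\mathbb C$ is a category enriched in $\mathscr F$: a (strict) 2-category $\mathbb C_\lambda$, whose 1-cells are the *loose* morphisms, with a wide and locally full sub-2-category $\mathbb C_\tau$, whose 1-cells are the *tight* morphisms; it is *chordate* if every loose morphism is tight. Hom-categories are small; the objects of $\mathbb C$ may form a large class. An *$\mathscr F$-functor* is a 2-functor between the 2-categories of loose morphisms that preserves tight morphisms. $\mathbb F$ is the $\mathscr F$-category whose objects are full embeddings, whose loose morphisms $A\to B$ are all functors $A_\lambda\to B_\lambda$, whose tight morphisms are those that restrict to $A_\tau\to B_\tau$, and whose 2-cells are natural transformations. **Limits.** An *$\mathscr F$-weight* is an $\mathscr F$-functor $W\colon\mathbb J\to\mathbb F$ with $\mathbb J$ small. For an $\mathscr F$-functor $D\colon\mathbb J\to\mathbb C$ and $X\in\mathbb C$, the object $[\mathbb J,\mathbb F](W,\mathbb C(X,D-))$ of $\mathscr F$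 has as loose part the category of 2-natural transformations $W_\lambda\Rightarrow\mathbb C_\lambda(X,D_\lambda-)$ and modifications, and as tight part its full subcategory on the $\mathscr F$-natural transformations (those with tight components). A *$W$-weighted cone* over $D$ with vertex $X$ is an $\mathscr F$-natural transformation $\gamma\colon W\Rightarrow\mathbb C(X,D-)$; it is a *limit cone* if for every $Z\in\mathbb C$ the morphism $\mathbb C(Z,X)\to[\mathbb J,\mathbb F](W,\mathbb C(Z,D-))$ of $\mathscr F$ induced by precomposition is invertible in $\mathscr F$. For a class $\Psi$ of $\mathscr F$-weights, $\mathbb C$ is *$\Psi$-complete* if every $D\colon \mathbb J\to\mathbb C$ has a $W$-weighted limit for each $(W\colon\mathbb J\to\mathbb F)\in\Psi$. A *tight* weight (a weight for tight limits) is an $\mathscr F$-weight $W\colon\mathbb J\to\mathbb F$ such that $\mathbb J$ is chordate and every full embedding $W(j)$ is an isomorphism; up to isomorphism, this is a 2-functor $\mathbb J\to\mathbf{Cat}$ with each value regarded as an identity embedding. **Sketches and models.** A *limit $\mathscr F$-sketch* $\mathcal S$ is an $\mathscr F$-category $\mathbb S$, here small, with a class of weighted cones in $\mathbb S$; it is a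 *$\Psi$-limit $\mathscr F$-sketch* if the weights of these cones lie in $\Psi$. A *model* of $\mathcal S$ in $\mathbb C$ is an $\mathscr F$-functor $\mathbb S\to\mathbb C$ that sends the given cones to limit cones. **Weaknesses.** The weaknesses are $s,p,l,c$ (strict, pseudo, lax, colax), with $s\le p\le l$ and $p\le c$. For $w'\le w$ and $\mathscr F$-functors $M,N\colon\mathbb S\to\mathbb C$, a *loose $(w',w)$-natural transformation* $\varphi\colon M\Rightarrow N$ consists of loose morphisms $\varphi_a\colon Ma\to Na$ and 2-cells $\varphi_f\colon Nf\circ\varphi_a\Rightarrow\varphi_b\circ Mf$ for loose $f\colon a\to b$ (in the opposite direction if $w=c$), compatible with identities, composites and 2-cells, such that each $\varphi_f$ is an identity if $w=s$, is invertible if $w=p$ and is arbitrary if $w\in\{l,c\}$, and such that, for $f$ tight, $\varphi_f$ satisfies in addition the condition for $w'$. It is *tight* if each $\varphi_a$ is tight and each $\varphi_f$ ($f$ loose) satisfies the condition for $w'$. $\mathrm{Mod}_{w',w}(\mathcal S,\mathbb C)$ is the $\mathscr F$-category of models of $\mathcal S$ in $\mathbb C$, loose $(w',w)$-natural transformations,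 tight $(w',w)$-natural transformations, and modifications. **Creation.** A class $\Psi$ of $\mathscr F$-weights is *$(w',w)$-created* if, for each small $\Psi$-limit $\mathscr F$-sketch $\mathcal S$ and each $\Psi$-complete $\mathscr F$-category $\mathbb C$, the $\mathscr F$-category $\mathrm{Mod}_{w',w}(\mathcal S,\mathbb C)$ is $\Psi$-complete, each evaluation $\mathscr F$-functor $(-)(S)\colon\mathrm{Mod}_{w',w}(\mathcal S,\mathbb C)\to\mathbb C$, for $S\in\mathbb S$, preserves $\Psi$-limit cones, and the evaluation $\mathscr F$-functors jointly reflect them (a weighted cone with weight in $\Psi$ is a limit cone if its image under every evaluation is). **Proposition.** 1. Every class $\Psi$ of $\mathscr F$-weights is $(s,s)$-created. 2. Every class $\Psi$ of tight weights is $(s,w)$-created, for every weakness $w\in\{s,p,l,c\}$. -/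

import Mathlib

open CategoryTheory Bicategory

universe u v v₁ v₂ v₃ v₄

namespace Enhanced

/-! ## `ℱ`-categories and `ℱ`-functors

`ℱ` is the category of full embeddings of small categories; "small" means living in `Type u`. -/

/-- An enhanced 2-category (`ℱ`-category) with class of objects `C`: a (strict) 2-category, whose
1-cells are the *loose* morphisms, together with a wide and locally full sub-2-category, whose
1-cells are the *tight* morphisms. The hom-categories are small. -/
class FCategory (C : Type v) extends Bicategory.{u, u} C where
  strict : Bicategory.Strict C
  /-- The tight morphisms. -/
  IsTight {a b : C} (f : a ⟶ b) : Prop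
  tight_id (a : C) : IsTight (𝟙 a)
  tight_comp {a b c : C} {f : a ⟶ b} {g : b ⟶ c} : IsTight f → IsTight g → IsTight (f ≫ g)

attribute [instance] FCategory.strict

/-- An `ℱ`-functor: a strict 2-functor (a lax functor whose comparison 2-cells are identities)
between the 2-categories of loose morphisms that preserves tightness. -/
structure FFunctor (A : Type v₁) [FCategory.{u} A] (B : Type v₂) [FCategory.{u} B] extends
    LaxFunctor A B where
  map_id (a : A) : map (𝟙 a) = 𝟙 (obj a)
  mapId_eq (a : A) : mapId a = eqToHom (map_id a).symm
  map_comp {a b c : A} (f : a ⟶ b) (g : b ⟶ c) : map (f ≫ g) = map f ≫ map g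
  mapComp_eq {a b c : A} (f : a ⟶ b) (g : b ⟶ c) : mapComp f g = eqToHom (map_comp f g).symm
  map_tight {a b : A} {f : a ⟶ b} : FCategory.IsTight f → FCategory.IsTight (map f)

namespace FFunctor
variable {A : Type v₁} [FCategory.{u} A] {B : Type v₂} [FCategory.{u} B]
  {C : Type v₃} [FCategory.{u} C]

lemma map₂_eqToHom (F : FFunctor A B) {a b : A} {f g : a ⟶ b} (h : f = g) :
    F.map₂ (eqToHom h) = eqToHom (congrArg F.map h) := by
  subst h; exact F.map₂_id _

lemma map₂_whiskerLeft' (F : FFunctor A B) {a b c : A} (f : a ⟶ b) {g h : b ⟶ c} (η : g ⟶ h) :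
    F.map₂ (f ◁ η) = eqToHom (F.map_comp f g) ≫ F.map f ◁ F.map₂ η ≫
      eqToHom (F.map_comp f h).symm := by
  have := F.mapComp_naturality_right f η
  rw [F.mapComp_eq, F.mapComp_eq] at this
  rw [← this]
  simp

lemma map₂_whiskerRight' (F : FFunctor A B) {a b c : A} {f g : a ⟶ b} (η : f ⟶ g) (h : b ⟶ c) :
    F.map₂ (η ▷ h) = eqToHom (F.map_comp f h) ≫ F.map₂ η ▷ F.map h ≫
      eqToHom (F.map_comp g h).symm := by
  have := F.mapComp_naturality_left η h
  rw [F.mapComp_eq, F.mapComp_eq] at this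
  rw [← this]
  simp

/-- Composition of `ℱ`-functors. -/
@[reducible]
def comp (F : FFunctor A B) (G : FFunctor B C) : FFunctor A C where
  obj a := G.obj (F.obj a)
  map f := G.map (F.map f)
  map₂ α := G.map₂ (F.map₂ α)
  map₂_id f := (F.toLaxFunctor.comp G.toLaxFunctor).map₂_id f
  map₂_comp α β := (F.toLaxFunctor.comp G.toLaxFunctor).map₂_comp α β
  mapId a := G.mapId (F.obj a) ≫ G.map₂ (F.mapId a)
  mapComp f g := G.mapComp (F.map f) (F.map g) ≫ G.map₂ (F.mapComp f g)
  mapComp_naturality_left α g := (F.toLaxFunctor.comp G.toLaxFunctor).mapComp_naturality_left α g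
  mapComp_naturality_right f _ _ α :=
    (F.toLaxFunctor.comp G.toLaxFunctor).mapComp_naturality_right f α
  map₂_associator f g h := (F.toLaxFunctor.comp G.toLaxFunctor).map₂_associator f g h
  map₂_leftUnitor f := (F.toLaxFunctor.comp G.toLaxFunctor).map₂_leftUnitor f
  map₂_rightUnitor f := (F.toLaxFunctor.comp G.toLaxFunctor).map₂_rightUnitor f
  map_id a := (congrArg G.map (F.map_id a)).trans (G.map_id _)
  mapId_eq a := by
    rw [F.mapId_eq, G.mapId_eq, map₂_eqToHom, eqToHom_trans]
  map_comp f g := (congrArg G.map (F.map_comp f g)).trans (G.map_comp _ _)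
  mapComp_eq f g := by
    rw [F.mapComp_eq, G.mapComp_eq, map₂_eqToHom, eqToHom_trans]
  map_tight h := G.map_tight (F.map_tight h)

end FFunctor

section OneCells

/-! ## Locally full sub-bicategories -/

variable {B : Type v} [Bicategory.{v₂, v₃} B] {X : Type v₁}

/-- A class of 1-cells of `B` between the objects in the image of `F : X → B`, containing the
identities and closed under composition. -/
structure OneCells (F : X → B) where
  P : ∀ {x y : X}, (F x ⟶ F y) → Prop
  id_mem : ∀ x, P (𝟙 (F x))
  comp_mem : ∀ {x y z : X} (f : F x ⟶ F y) (g : F y ⟶ F z), P f → P g → P (f ≫ g)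

variable {F : X → B}

/-- The objects `X`, regarded as those of the bicategory whose 1-cells are the 1-cells of `B` in
the class `T`, and whose 2-cells are all the 2-cells of `B` between them. -/
def OneCells.Obj (_ : OneCells F) : Type v₁ := X

variable {T : OneCells F}

namespace OneCells

/-- The 1-cells. -/
@[ext]
structure Hom (T : OneCells F) (x y : X) where
  hom : F x ⟶ F y
  mem : T.P hom

/-- The 2-cells. -/
@[ext]
structure Hom₂ {x y : X} (f g : Hom T x y) where
  cell : f.hom ⟶ g.hom

@[simps id_hom comp_hom]
instance categoryStruct : CategoryStruct T.Obj where
  Hom x y := Hom T x y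
  id x := ⟨𝟙 (F x), T.id_mem x⟩
  comp f g := ⟨f.hom ≫ g.hom, T.comp_mem _ _ f.mem g.mem⟩

@[simps id_cell comp_cell]
instance homCategory (x y : T.Obj) : Category (x ⟶ y) where
  Hom f g := Hom₂ f g
  id f := ⟨𝟙 f.hom⟩
  comp α β := ⟨α.cell ≫ β.cell⟩

@[ext] lemma hom_ext {x y : T.Obj} {f g : x ⟶ y} (h : f.hom = g.hom) : f = g := Hom.ext h
@[ext] lemma hom₂_ext {x y : T.Obj} {f g : x ⟶ y} {α β : f ⟶ g} (h : α.cell = β.cell) :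
  α = β := Hom₂.ext h

/-- Invertible 2-cells. -/
@[simps]
def isoMk {x y : T.Obj} {f g : x ⟶ y} (φ : f.hom ≅ g.hom) : f ≅ g where
  hom := ⟨φ.hom⟩
  inv := ⟨φ.inv⟩

/-- Left whiskering. -/
@[simps]
def whiskerLeft {x y z : T.Obj} (h : x ⟶ y) {f g : y ⟶ z} (α : f ⟶ g) : h ≫ f ⟶ h ≫ g where
  cell := h.hom ◁ α.cell

/-- Right whiskering. -/
@[simps]
def whiskerRight {x y z : T.Obj} {f g : x ⟶ y} (α : f ⟶ g) (h : y ⟶ z) : f ≫ h ⟶ g ≫ h where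
  cell := α.cell ▷ h.hom

/-- The associator. -/
@[simps!]
def associator {x y z t : T.Obj} (f : x ⟶ y) (g : y ⟶ z) (h : z ⟶ t) :
    (f ≫ g) ≫ h ≅ f ≫ g ≫ h :=
  isoMk (α_ f.hom g.hom h.hom)

/-- The left unitor. -/
@[simps!]
def leftUnitor {x y : T.Obj} (f : x ⟶ y) : 𝟙 x ≫ f ≅ f := isoMk (λ_ f.hom)

/-- The right unitor. -/
@[simps!]
def rightUnitor {x y : T.Obj} (f : x ⟶ y) : f ≫ 𝟙 y ≅ f := isoMk (ρ_ f.hom)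

@[simps! whiskerLeft_cell whiskerRight_cell associator_hom_cell associator_inv_cell
  leftUnitor_hom_cell leftUnitor_inv_cell rightUnitor_hom_cell rightUnitor_inv_cell]
instance bicategory : Bicategory T.Obj where
  whiskerLeft h _ _ α := whiskerLeft h α
  whiskerRight α h := whiskerRight α h
  associator f g h := associator f g h
  leftUnitor f := leftUnitor f
  rightUnitor f := rightUnitor f
  whisker_exchange η θ := by ext; simpa using whisker_exchange _ _

lemma eqToHom_cell {x y : T.Obj} {f g : x ⟶ y} (h : f = g) :
    (eqToHom h).cell = eqToHom (congrArg Hom.hom h) := by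
  subst h; rfl

instance strict [Bicategory.Strict B] : Bicategory.Strict T.Obj where
  id_comp f := by ext; exact Bicategory.Strict.id_comp f.hom
  comp_id f := by ext; exact Bicategory.Strict.comp_id f.hom
  assoc f g h := by ext; exact Bicategory.Strict.assoc f.hom g.hom h.hom
  leftUnitor_eqToIso f := by
    ext; simp [eqToHom_cell, Bicategory.Strict.leftUnitor_eqToIso]
  rightUnitor_eqToIso f := by
    ext; simp [eqToHom_cell, Bicategory.Strict.rightUnitor_eqToIso]
  associator_eqToIso f g h := by
    ext; simp [eqToHom_cell, Bicategory.Strict.associator_eqToIso]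

end OneCells

end OneCells


section Strict

/-! ## The 2-categories of lax functors, with lax or with oplax transformations, are strict
when the codomain is -/

variable {A : Type v₁} [Bicategory.{u, u} A] {B : Type v₂} [Bicategory.{u, u} B]

namespace LaxAux

open scoped Lax.LaxTrans Lax.LaxTrans.LaxFunctor

lemma eqToHom_app {M N : A ⥤ᴸ B} {φ ψ : M ⟶ N} (h : φ = ψ) (a : A) :
    (eqToHom h).as.app a = eqToHom (by rw [h]) := by
  subst h; rfl

lemma eq_of_mod {M N : A ⥤ᴸ B} {φ ψ : M ⟶ N} (Γ : φ ⟶ ψ)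
    (h : ∀ a, ∃ p : φ.app a = ψ.app a, Γ.as.app a = eqToHom p) : φ = ψ := by
  obtain ⟨⟨γ, hγ⟩⟩ := Γ
  change Lax.LaxTrans M N at φ ψ
  cases φ with | mk p n _ _ _ =>
  cases ψ with | mk p' n' _ _ _ =>
  obtain rfl : p = p' := funext fun a => (h a).1
  have h' : ∀ a, γ a = 𝟙 _ := fun a => (h a).2
  have : @n = @n' := by
    funext a b f
    simpa [h'] using (hγ f).symm
  subst this; rfl

instance strict [Bicategory.Strict B] : Bicategory.Strict (A ⥤ᴸ B) where
  id_comp f := eq_of_mod (λ_ f).hom fun a =>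
    ⟨Strict.id_comp _, by simp [Strict.leftUnitor_eqToIso]; rfl⟩
  comp_id f := eq_of_mod (ρ_ f).hom fun a =>
    ⟨Strict.comp_id _, by simp [Strict.rightUnitor_eqToIso]; rfl⟩
  assoc f g h := eq_of_mod (α_ f g h).hom fun a =>
    ⟨Strict.assoc _ _ _, by simp [Strict.associator_eqToIso]; rfl⟩
  leftUnitor_eqToIso f := by
    ext; simp [eqToHom_app, Strict.leftUnitor_eqToIso]; rfl
  rightUnitor_eqToIso f := by
    ext; simp [eqToHom_app, Strict.rightUnitor_eqToIso]; rfl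
  associator_eqToIso f g h := by
    ext; simp [eqToHom_app, Strict.associator_eqToIso]; rfl

end LaxAux

namespace OplaxAux

open scoped Lax.OplaxTrans Lax.OplaxTrans.LaxFunctor

lemma eqToHom_app {M N : A ⥤ᴸ B} {φ ψ : M ⟶ N} (h : φ = ψ) (a : A) :
    (eqToHom h).as.app a = eqToHom (by rw [h]) := by
  subst h; rfl

lemma eq_of_mod {M N : A ⥤ᴸ B} {φ ψ : M ⟶ N} (Γ : φ ⟶ ψ)
    (h : ∀ a, ∃ p : φ.app a = ψ.app a, Γ.as.app a = eqToHom p) : φ = ψ := by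
  obtain ⟨⟨γ, hγ⟩⟩ := Γ
  change Lax.OplaxTrans M N at φ ψ
  cases φ with | mk p n _ _ _ =>
  cases ψ with | mk p' n' _ _ _ =>
  obtain rfl : p = p' := funext fun a => (h a).1
  have h' : ∀ a, γ a = 𝟙 _ := fun a => (h a).2
  have : @n = @n' := by
    funext a b f
    simpa [h'] using (hγ f).symm
  subst this; rfl

instance strict [Bicategory.Strict B] : Bicategory.Strict (A ⥤ᴸ B) where
  id_comp f := eq_of_mod (λ_ f).hom fun a =>
    ⟨Strict.id_comp _, by simp [Strict.leftUnitor_eqToIso]; rfl⟩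
  comp_id f := eq_of_mod (ρ_ f).hom fun a =>
    ⟨Strict.comp_id _, by simp [Strict.rightUnitor_eqToIso]; rfl⟩
  assoc f g h := eq_of_mod (α_ f g h).hom fun a =>
    ⟨Strict.assoc _ _ _, by simp [Strict.associator_eqToIso]; rfl⟩
  leftUnitor_eqToIso f := by
    ext; simp [eqToHom_app, Strict.leftUnitor_eqToIso]; rfl
  rightUnitor_eqToIso f := by
    ext; simp [eqToHom_app, Strict.rightUnitor_eqToIso]; rfl
  associator_eqToIso f g h := by
    ext; simp [eqToHom_app, Strict.associator_eqToIso]; rfl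

end OplaxAux

end Strict

/-! ## Weaknesses -/

/-- The weaknesses: strict, pseudo, lax, colax. They are ordered by `s ≤ p`, `p ≤ l`, `p ≤ c`. -/
inductive Weakness
  | s | p | l | c

/-- A 2-cell, in the direction of an `l`-cell (or, for colax transformations, of a `c`-cell), is a
`w`-cell if it is an identity for `w = s`, invertible for `w = p`, and arbitrary otherwise. -/
def Weakness.IsCell (w : Weakness) {H : Type v₁} [Category.{v₂} H] {f g : H} (α : f ⟶ g) : Prop :=
  match w with
  | .s => ∃ h : f = g, α = eqToHom h
  | .p => IsIso α
  | .l => True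
  | .c => True

namespace Weakness

lemma isCell_eqToHom {H : Type v₁} [Category.{v₂} H] {f g : H} (h : f = g) (w : Weakness) :
    w.IsCell (eqToHom h) := by
  cases w with
  | s => exact ⟨h, rfl⟩
  | p => exact (inferInstance : IsIso (eqToHom h))
  | l => trivial
  | c => trivial

lemma isCell_comp {H : Type v₁} [Category.{v₂} H] {f g h : H} {α : f ⟶ g} {β : g ⟶ h}
    {w : Weakness} (hα : w.IsCell α) (hβ : w.IsCell β) : w.IsCell (α ≫ β) := by
  cases w with
  | s =>
    obtain ⟨rfl, rfl⟩ := hα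
    obtain ⟨rfl, rfl⟩ := hβ
    exact ⟨rfl, by simp⟩
  | p => exact @IsIso.comp_isIso _ _ _ _ _ _ _ hα hβ
  | l => trivial
  | c => trivial

lemma isCell_map {H : Type v₁} [Category.{v₂} H] {K : Type v₃} [Category.{u} K] (F : H ⥤ K)
    {f g : H} {α : f ⟶ g} {w : Weakness} (hα : w.IsCell α) : w.IsCell (F.map α) := by
  cases w with
  | s =>
    obtain ⟨rfl, rfl⟩ := hα
    exact ⟨rfl, by simp⟩
  | p => exact @Functor.map_isIso _ _ _ _ _ _ F α hα
  | l => trivial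
  | c => trivial

end Weakness


section Functors

/-! ## `ℱ`-categories of `ℱ`-functors and loose `(w', w)`-natural transformations -/

variable {S : Type u} [FCategory.{u} S] {C : Type v₁} [FCategory.{u} C] {X : Type v₂}

namespace LaxAux

open scoped Lax.LaxTrans Lax.LaxTrans.LaxFunctor

lemma id_isCell (w : Weakness) (M : S ⥤ᴸ C) {a b : S} (f : a ⟶ b) :
    w.IsCell (Lax.LaxTrans.naturality (𝟙 M) f) := by
  simp only [Lax.LaxTrans.id_naturality, Strict.leftUnitor_eqToIso, Strict.rightUnitor_eqToIso,
    eqToIso.hom, eqToIso.inv]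
  exact w.isCell_comp (w.isCell_eqToHom _) (w.isCell_eqToHom _)

lemma comp_isCell (w : Weakness) {M N P : S ⥤ᴸ C} (φ : M ⟶ N) (ψ : N ⟶ P) {a b : S}
    (f : a ⟶ b) (h : w.IsCell (φ.naturality f)) (h' : w.IsCell (ψ.naturality f)) :
    w.IsCell (Lax.LaxTrans.naturality (φ ≫ ψ) f) := by
  simp only [Lax.LaxTrans.comp_naturality, Strict.associator_eqToIso, eqToIso.hom, eqToIso.inv]
  exact w.isCell_comp (w.isCell_eqToHom _) (w.isCell_comp (w.isCell_map (precomp _ _) h')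
    (w.isCell_comp (w.isCell_eqToHom _) (w.isCell_comp (w.isCell_map (postcomp _ _) h)
      (w.isCell_eqToHom _))))

/-- Loose `(w', w)`-natural transformations for `w ∈ {s, p, l}`: lax transformations, with structure
2-cells `φ_f : φ_a ≫ N f ⟶ M f ≫ φ_b` that are `w`-cells, and `w'`-cells when `f` is tight. -/
def cells (w' w : Weakness) (obj : X → FFunctor S C) :
    OneCells (fun x => (obj x).toLaxFunctor) where
  P φ := (∀ {a b : S} (f : a ⟶ b), w.IsCell (φ.naturality f)) ∧
    ∀ {a b : S} (f : a ⟶ b), FCategory.IsTight f → w'.IsCell (φ.naturality f)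
  id_mem _ := ⟨fun _ => id_isCell w _ _, fun _ _ => id_isCell w' _ _⟩
  comp_mem φ ψ hφ hψ := ⟨fun f => comp_isCell w φ ψ f (hφ.1 f) (hψ.1 f),
    fun f hf => comp_isCell w' φ ψ f (hφ.2 f hf) (hψ.2 f hf)⟩

/-- A loose transformation is tight when its components are tight and all of its structure
2-cells are `w'`-cells. The 2-cells are the modifications. -/
instance fcategory (w' w : Weakness) (obj : X → FFunctor S C) :
    FCategory.{u} (cells w' w obj).Obj where
  toBicategory := OneCells.bicategory
  strict := OneCells.strict
  IsTight φ := (∀ a, FCategory.IsTight (φ.hom.app a)) ∧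
    ∀ {a b : S} (f : a ⟶ b), w'.IsCell (φ.hom.naturality f)
  tight_id _ := ⟨fun _ => FCategory.tight_id _, fun _ => id_isCell w' _ _⟩
  tight_comp hφ hψ := ⟨fun a => FCategory.tight_comp (hφ.1 a) (hψ.1 a),
    fun f => comp_isCell w' _ _ f (hφ.2 f) (hψ.2 f)⟩

/-- Evaluation at `a`. -/
def eval (w' w : Weakness) (obj : X → FFunctor S C) (a : S) :
    FFunctor (cells w' w obj).Obj C where
  obj x := (obj x).obj a
  map φ := φ.hom.app a
  map₂ Γ := Γ.cell.as.app a
  map₂_id _ := rfl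
  map₂_comp _ _ := rfl
  mapId _ := 𝟙 _
  mapComp _ _ := 𝟙 _
  mapComp_naturality_left _ _ := (Category.id_comp _).trans (Category.comp_id _).symm
  mapComp_naturality_right _ _ _ _ := (Category.id_comp _).trans (Category.comp_id _).symm
  map₂_associator f g h := by
    change 𝟙 (f.hom.app a ≫ g.hom.app a) ▷ h.hom.app a ≫
        𝟙 ((f.hom.app a ≫ g.hom.app a) ≫ h.hom.app a) ≫ (α_ _ _ _).hom =
      (α_ _ _ _).hom ≫ f.hom.app a ◁ 𝟙 (g.hom.app a ≫ h.hom.app a) ≫ 𝟙 _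
    simp
  map₂_leftUnitor f := by
    change (λ_ (f.hom.app a)).inv = (λ_ (f.hom.app a)).inv ≫ 𝟙 (𝟙 _) ▷ f.hom.app a ≫ 𝟙 _
    simp
  map₂_rightUnitor f := by
    change (ρ_ (f.hom.app a)).inv = (ρ_ (f.hom.app a)).inv ≫ f.hom.app a ◁ 𝟙 (𝟙 _) ≫ 𝟙 _
    simp
  map_id _ := rfl
  mapId_eq _ := rfl
  map_comp _ _ := rfl
  mapComp_eq _ _ := rfl
  map_tight h := h.1 a

end LaxAux
namespace OplaxAux

open scoped Lax.OplaxTrans Lax.OplaxTrans.LaxFunctor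

lemma id_isCell (w : Weakness) (M : S ⥤ᴸ C) {a b : S} (f : a ⟶ b) :
    w.IsCell (Lax.OplaxTrans.naturality (𝟙 M) f) := by
  simp only [Lax.OplaxTrans.id_naturality, Strict.leftUnitor_eqToIso, Strict.rightUnitor_eqToIso,
    eqToIso.hom, eqToIso.inv]
  exact w.isCell_comp (w.isCell_eqToHom _) (w.isCell_eqToHom _)

lemma comp_isCell (w : Weakness) {M N P : S ⥤ᴸ C} (φ : M ⟶ N) (ψ : N ⟶ P) {a b : S}
    (f : a ⟶ b) (h : w.IsCell (φ.naturality f)) (h' : w.IsCell (ψ.naturality f)) :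
    w.IsCell (Lax.OplaxTrans.naturality (φ ≫ ψ) f) := by
  simp only [Lax.OplaxTrans.comp_naturality, Strict.associator_eqToIso, eqToIso.hom, eqToIso.inv]
  exact w.isCell_comp (w.isCell_eqToHom _) (w.isCell_comp (w.isCell_map (postcomp _ _) h)
    (w.isCell_comp (w.isCell_eqToHom _) (w.isCell_comp (w.isCell_map (precomp _ _) h')
      (w.isCell_eqToHom _))))

/-- Loose `(w', w)`-natural transformations for `w = c`: colax transformations, with structure
2-cells `φ_f : M f ≫ φ_b ⟶ φ_a ≫ N f` that are `w`-cells, and `w'`-cells when `f` is tight. -/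
def cells (w' w : Weakness) (obj : X → FFunctor S C) :
    OneCells (fun x => (obj x).toLaxFunctor) where
  P φ := (∀ {a b : S} (f : a ⟶ b), w.IsCell (φ.naturality f)) ∧
    ∀ {a b : S} (f : a ⟶ b), FCategory.IsTight f → w'.IsCell (φ.naturality f)
  id_mem _ := ⟨fun _ => id_isCell w _ _, fun _ _ => id_isCell w' _ _⟩
  comp_mem φ ψ hφ hψ := ⟨fun f => comp_isCell w φ ψ f (hφ.1 f) (hψ.1 f),
    fun f hf => comp_isCell w' φ ψ f (hφ.2 f hf) (hψ.2 f hf)⟩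

/-- A loose transformation is tight when its components are tight and all of its structure
2-cells are `w'`-cells. The 2-cells are the modifications. -/
instance fcategory (w' w : Weakness) (obj : X → FFunctor S C) :
    FCategory.{u} (cells w' w obj).Obj where
  toBicategory := OneCells.bicategory
  strict := OneCells.strict
  IsTight φ := (∀ a, FCategory.IsTight (φ.hom.app a)) ∧
    ∀ {a b : S} (f : a ⟶ b), w'.IsCell (φ.hom.naturality f)
  tight_id _ := ⟨fun _ => FCategory.tight_id _, fun _ => id_isCell w' _ _⟩
  tight_comp hφ hψ := ⟨fun a => FCategory.tight_comp (hφ.1 a) (hψ.1 a),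
    fun f => comp_isCell w' _ _ f (hφ.2 f) (hψ.2 f)⟩

/-- Evaluation at `a`. -/
def eval (w' w : Weakness) (obj : X → FFunctor S C) (a : S) :
    FFunctor (cells w' w obj).Obj C where
  obj x := (obj x).obj a
  map φ := φ.hom.app a
  map₂ Γ := Γ.cell.as.app a
  map₂_id _ := rfl
  map₂_comp _ _ := rfl
  mapId _ := 𝟙 _
  mapComp _ _ := 𝟙 _
  mapComp_naturality_left _ _ := (Category.id_comp _).trans (Category.comp_id _).symm
  mapComp_naturality_right _ _ _ _ := (Category.id_comp _).trans (Category.comp_id _).symm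
  map₂_associator f g h := by
    change 𝟙 (f.hom.app a ≫ g.hom.app a) ▷ h.hom.app a ≫
        𝟙 ((f.hom.app a ≫ g.hom.app a) ≫ h.hom.app a) ≫ (α_ _ _ _).hom =
      (α_ _ _ _).hom ≫ f.hom.app a ◁ 𝟙 (g.hom.app a ≫ h.hom.app a) ≫ 𝟙 _
    simp
  map₂_leftUnitor f := by
    change (λ_ (f.hom.app a)).inv = (λ_ (f.hom.app a)).inv ≫ 𝟙 (𝟙 _) ▷ f.hom.app a ≫ 𝟙 _
    simp
  map₂_rightUnitor f := by
    change (ρ_ (f.hom.app a)).inv = (ρ_ (f.hom.app a)).inv ≫ f.hom.app a ◁ 𝟙 (𝟙 _) ≫ 𝟙 _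
    simp
  map_id _ := rfl
  mapId_eq _ := rfl
  map_comp _ _ := rfl
  mapComp_eq _ _ := rfl
  map_tight h := h.1 a

end OplaxAux

/-- The `ℱ`-category whose objects are the elements of `X`, regarded as `ℱ`-functors through `obj`,
whose loose morphisms are the loose `(w', w)`-natural transformations (for `w' ≤ w`), and whose
2-cells are the modifications. For `obj = id` it is `Fun_{w', w}(S, C)`; for the inclusion of a
subtype of `ℱ`-functors it is the full sub-`ℱ`-category of `Fun_{w', w}(S, C)` on that subtype. -/
def FunOn (_w' _w : Weakness) (_obj : X → FFunctor S C) : Type v₂ := X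

instance FunOn.fcategory (w' w : Weakness) (obj : X → FFunctor S C) :
    FCategory.{u} (FunOn w' w obj) :=
  match w with
  | .s => LaxAux.fcategory w' .s obj
  | .p => LaxAux.fcategory w' .p obj
  | .l => LaxAux.fcategory w' .l obj
  | .c => OplaxAux.fcategory w' .c obj

/-- The evaluation `ℱ`-functor at `a`. -/
def FunOn.eval (w' w : Weakness) (obj : X → FFunctor S C) (a : S) :
    FFunctor (FunOn w' w obj) C :=
  match w with
  | .s => LaxAux.eval w' .s obj a
  | .p => LaxAux.eval w' .p obj a
  | .l => LaxAux.eval w' .l obj a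
  | .c => OplaxAux.eval w' .c obj a

end Functors

/-! ## The `ℱ`-category `𝔽` -/

/-- A full embedding of small categories: a fully faithful and injective-on-objects functor. -/
structure FullEmb : Type (u + 1) where
  tight : Cat.{u, u}
  loose : Cat.{u, u}
  incl : tight ⥤ loose
  full : incl.Full
  faithful : incl.Faithful
  injective : Function.Injective incl.obj

/-- The `ℱ`-category `𝔽`: objects are full embeddings, loose morphisms are functors between the
loose parts, 2-cells are natural transformations, and a loose morphism is tight when it restricts
to a functor between the tight parts. -/
def BbF : Type (u + 1) := InducedBicategory Cat.{u, u} FullEmb.loose.{u}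

instance : Bicategory.{u, u} BbF.{u} :=
  inferInstanceAs (Bicategory.{u, u} (InducedBicategory Cat.{u, u} FullEmb.loose.{u}))

instance : FCategory.{u} BbF.{u} where
  toBicategory := inferInstance
  strict := inferInstanceAs (Bicategory.Strict (InducedBicategory Cat.{u, u} FullEmb.loose.{u}))
  IsTight {A B} f := ∃ g : FullEmb.tight A ⥤ FullEmb.tight B,
    FullEmb.incl A ⋙ f.hom.toFunctor = g ⋙ FullEmb.incl B
  tight_id A := ⟨𝟭 _, rfl⟩
  tight_comp {A B C f g} := by
    rintro ⟨f', hf⟩ ⟨g', hg⟩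
    refine ⟨f' ⋙ g', ?_⟩
    change (FullEmb.incl A ⋙ f.hom.toFunctor) ⋙ g.hom.toFunctor = f' ⋙ (g' ⋙ FullEmb.incl C)
    rw [hf, ← hg]
    rfl

/-! ## Weighted cones and weighted limits -/

section Cones

variable {J : Type u} [FCategory.{u} J]

/-- The loose part of the value of a weight at an object. -/
abbrev wObj (W : FFunctor J BbF.{u}) (j : J) : Cat.{u, u} := FullEmb.loose (W.obj j)

/-- The action of a weight on loose morphisms. -/
abbrev wMap (W : FFunctor J BbF.{u}) {i j : J} (f : i ⟶ j) : wObj W i ⥤ wObj W j :=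
  (W.map f).hom.toFunctor

/-- The action of a weight on 2-cells. -/
abbrev wMap₂ (W : FFunctor J BbF.{u}) {i j : J} {f g : i ⟶ j} (α : f ⟶ g) :
    wMap W f ⟶ wMap W g :=
  (W.map₂ α).hom.toNatTrans

variable {K : Type v₁} [FCategory.{u} K] {L : Type v₂} [FCategory.{u} L]

/-- The 2-natural transformations `W_λ ⇒ K_λ(X, D_λ -)`. These are the objects of the loose part
of the full embedding `[J, 𝔽](W, K(X, D -))`. -/
structure LooseCone (W : FFunctor J BbF.{u}) (D : FFunctor J K) (X : K) where
  proj (j : J) : wObj W j ⥤ (X ⟶ D.obj j)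
  naturality_obj {i j : J} (f : i ⟶ j) (y : wObj W i) :
    (proj j).obj ((wMap W f).obj y) = (proj i).obj y ≫ D.map f
  naturality_map {i j : J} (f : i ⟶ j) {y z : wObj W i} (t : y ⟶ z) :
    (proj j).map ((wMap W f).map t) = eqToHom (naturality_obj f y) ≫
      (proj i).map t ▷ D.map f ≫ eqToHom (naturality_obj f z).symm
  naturality₂ {i j : J} {f g : i ⟶ j} (α : f ⟶ g) (y : wObj W i) :
    (proj j).map ((wMap₂ W α).app y) = eqToHom (naturality_obj f y) ≫
      (proj i).obj y ◁ D.map₂ α ≫ eqToHom (naturality_obj g y).symm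

namespace LooseCone

variable {W : FFunctor J BbF.{u}} {D : FFunctor J K} {X : K}

/-- The modifications between such 2-natural transformations. These are the morphisms of the loose
part of `[J, 𝔽](W, K(X, D -))`. -/
@[ext]
structure Hom (γ δ : LooseCone W D X) where
  app (j : J) : γ.proj j ⟶ δ.proj j
  naturality {i j : J} (f : i ⟶ j) (y : wObj W i) :
    (app j).app ((wMap W f).obj y) = eqToHom (γ.naturality_obj f y) ≫
      (app i).app y ▷ D.map f ≫ eqToHom (δ.naturality_obj f y).symm

@[simps id_app comp_app]
instance category : Category (LooseCone W D X) where
  Hom := Hom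
  id γ :=
    { app j := 𝟙 (γ.proj j)
      naturality f y := by simp }
  comp Γ Γ' :=
    { app j := Γ.app j ≫ Γ'.app j
      naturality f y := by simp [Γ.naturality, Γ'.naturality] }

@[ext]
lemma hom_ext {γ δ : LooseCone W D X} {Γ Γ' : γ ⟶ δ} (h : ∀ j, Hom.app Γ j = Hom.app Γ' j) :
    Γ = Γ' :=
  Hom.ext (funext h)

/-- The tight part of `[J, 𝔽](W, K(X, D -))`: the `ℱ`-natural transformations `W ⇒ K(X, D -)`,
whose components `W(j) ⟶ K(X, D j)` are tight morphisms of `𝔽`, which is to say that the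
projections at the objects of the tight part of `W(j)` are tight. -/
def IsTight (γ : LooseCone W D X) : Prop :=
  ∀ (j : J) (y : FullEmb.tight (W.obj j)),
    FCategory.IsTight ((γ.proj j).obj ((FullEmb.incl (W.obj j)).obj y))

/-- The cone obtained by precomposition with a loose morphism. -/
@[simps]
def precompose (γ : LooseCone W D X) {Z : K} (f : Z ⟶ X) : LooseCone W D Z where
  proj j :=
    { obj y := f ≫ (γ.proj j).obj y
      map t := f ◁ (γ.proj j).map t }
  naturality_obj g y := by
    dsimp only
    rw [γ.naturality_obj, Strict.assoc]
  naturality_map g y z t := by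
    dsimp only
    rw [γ.naturality_map, whisker_assoc]
    simp [Strict.associator_eqToIso]
  naturality₂ α y := by
    dsimp only
    rw [γ.naturality₂, comp_whiskerLeft]
    simp [Strict.associator_eqToIso]

lemma whiskerRight_congr {X Y Z : K} {f g : X ⟶ Y} (α : f ⟶ g) {p q : Y ⟶ Z} (h : p = q) :
    α ▷ p = eqToHom (by rw [h]) ≫ α ▷ q ≫ eqToHom (by rw [h]) := by
  subst h; simp

/-- The modification obtained by whiskering with a 2-cell. -/
@[simps]
def precomposeMap (γ : LooseCone W D X) {Z : K} {f g : Z ⟶ X} (α : f ⟶ g) :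
    Hom (γ.precompose f) (γ.precompose g) where
  app j :=
    { app y := α ▷ (γ.proj j).obj y
      naturality _ _ t := whisker_exchange α ((γ.proj j).map t) }
  naturality f y := by
    dsimp only [precompose_proj_obj]
    rw [whiskerRight_congr α (γ.naturality_obj f y), whiskerRight_comp]
    simp [Strict.associator_eqToIso]; rfl

/-- The (loose part of the) morphism `K(Z, X) ⟶ [J, 𝔽](W, K(Z, D -))` of `ℱ` induced by a cone. -/
@[simps]
def compare (γ : LooseCone W D X) (Z : K) : (Z ⟶ X) ⥤ LooseCone W D Z where
  obj f := γ.precompose f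
  map α := γ.precomposeMap α
  map_id f := hom_ext fun j => by ext y; exact id_whiskerRight _ _
  map_comp α β := hom_ext fun j => by ext y; exact comp_whiskerRight _ _ _

/-- `γ` is a limit cone when each induced morphism `K(Z, X) ⟶ [J, 𝔽](W, K(Z, D -))` of `ℱ` is
invertible, i.e. is an isomorphism of categories that restricts to an isomorphism between the
tight parts. -/
structure IsLimit (γ : LooseCone W D X) : Prop where
  bijective (Z : K) : Function.Bijective (γ.compare Z).obj
  full (Z : K) : (γ.compare Z).Full
  faithful (Z : K) : (γ.compare Z).Faithful
  tight_iff {Z : K} (f : Z ⟶ X) : FCategory.IsTight f ↔ ((γ.compare Z).obj f).IsTight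

/-- The image of a cone under an `ℱ`-functor. -/
@[simps]
def map (γ : LooseCone W D X) (F : FFunctor K L) : LooseCone W (D.comp F) (F.obj X) where
  proj j :=
    { obj y := F.map ((γ.proj j).obj y)
      map t := F.map₂ ((γ.proj j).map t)
      map_id y := by rw [(γ.proj j).map_id, F.map₂_id]
      map_comp t t' := by rw [(γ.proj j).map_comp, F.map₂_comp] }
  naturality_obj f y := (congrArg F.map (γ.naturality_obj f y)).trans (F.map_comp _ _)
  naturality_map g y z t := by
    dsimp only
    rw [γ.naturality_map, F.map₂_comp, F.map₂_comp, F.map₂_eqToHom, F.map₂_eqToHom,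
      F.map₂_whiskerRight']
    simp
  naturality₂ α y := by
    dsimp only
    rw [γ.naturality₂, F.map₂_comp, F.map₂_comp, F.map₂_eqToHom, F.map₂_eqToHom,
      F.map₂_whiskerLeft']
    simp

end LooseCone

end Cones

/-- An `ℱ`-weight: an `ℱ`-functor `J ⟶ 𝔽` with `J` small. -/
structure Weight : Type (u + 1) where
  J : Type u
  [str : FCategory.{u} J]
  W : FFunctor J BbF.{u}

attribute [instance] Weight.str

/-- The weights for tight limits: every morphism of `J` is tight, and every `W(j)` is an
isomorphism between its tight part and its loose part. (A full embedding is an isomorphism as soon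
as it is surjective on objects.) Up to isomorphism, these are the weights induced by the 2-functors
`W : J ⟶ CAT`, with `J` regarded as a chordate `ℱ`-category and `W(j)` as the identity embedding. -/
def Weight.IsTight (Φ : Weight.{u}) : Prop :=
  (∀ {i j : Φ.J} (f : i ⟶ j), FCategory.IsTight f) ∧
    ∀ j : Φ.J, Function.Surjective (FullEmb.incl (Φ.W.obj j)).obj

/-- A weighted cone in `C`. -/
structure WeightedCone (C : Type v) [FCategory.{u} C] where
  weight : Weight.{u}
  D : FFunctor weight.J C
  pt : C
  cone : LooseCone weight.W D pt
  tight : cone.IsTight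

section Limits

variable {A : Type v₁} [FCategory.{u} A] {B : Type v₂} [FCategory.{u} B]

/-- The image of a weighted cone under an `ℱ`-functor. -/
@[simps]
def WeightedCone.map (κ : WeightedCone A) (F : FFunctor A B) : WeightedCone B where
  weight := κ.weight
  D := κ.D.comp F
  pt := F.obj κ.pt
  cone := κ.cone.map F
  tight j y := F.map_tight (κ.tight j y)

/-- `A` has all limits with weight in `Ψ`. -/
def IsComplete (Ψ : Set Weight.{u}) (A : Type v₁) [FCategory.{u} A] : Prop :=
  ∀ Φ ∈ Ψ, ∀ D : FFunctor Φ.J A,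
    ∃ (X : A) (γ : LooseCone Φ.W D X), γ.IsTight ∧ γ.IsLimit

/-- `G` sends limit cones with weight in `Ψ` to limit cones. -/
def PreservesLimits (Ψ : Set Weight.{u}) (G : FFunctor A B) : Prop :=
  ∀ κ : WeightedCone A, κ.weight ∈ Ψ → κ.cone.IsLimit → (κ.map G).cone.IsLimit

/-- A weighted cone with weight in `Ψ` is a limit cone as soon as all its images under the `G i`
are limit cones. -/
def JointlyReflectLimits (Ψ : Set Weight.{u}) {ι : Type v₃} (G : ι → FFunctor A B) : Prop :=
  ∀ κ : WeightedCone A, κ.weight ∈ Ψ → (∀ i, (κ.map (G i)).cone.IsLimit) → κ.cone.IsLimit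

end Limits

/-! ## Sketches and models -/

/-- A limit `ℱ`-sketch: an `ℱ`-category with a class of weighted cones. (A sketch is small when
its class of objects lies in `Type u`.) -/
structure Sketch : Type (max (u + 1) (v + 1)) where
  carrier : Type v
  [str : FCategory.{u} carrier]
  cones : Set (WeightedCone.{u, v} carrier)

attribute [instance] Sketch.str

/-- A `Ψ`-limit sketch. -/
def Sketch.IsLimitSketch (𝒮 : Sketch.{u, v}) (Ψ : Set Weight.{u}) : Prop :=
  ∀ κ ∈ 𝒮.cones, κ.weight ∈ Ψ

/-- The sketch of all limit cones of an `ℱ`-category. -/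
def Sketch.ofFCategory (C : Type v) [FCategory.{u} C] : Sketch.{u, v} where
  carrier := C
  cones := {κ | κ.cone.IsLimit}

/-- The models of a (small) sketch in a sketch. -/
def Model (𝒮 : Sketch.{u, u}) (𝒯 : Sketch.{u, v}) : Type (max u v) :=
  {M : FFunctor 𝒮.carrier 𝒯.carrier // ∀ κ ∈ 𝒮.cones, κ.map M ∈ 𝒯.cones}

/-- The `ℱ`-category `Mod_{w', w}(𝒮, 𝒯)`, the full sub-`ℱ`-category of the `ℱ`-category of
`ℱ`-functors and loose `(w', w)`-natural transformations on the models. -/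
abbrev Mod (w' w : Weakness) (𝒮 : Sketch.{u, u}) (𝒯 : Sketch.{u, v}) : Type (max u v) :=
  FunOn w' w (fun M : Model 𝒮 𝒯 => M.1)

/-- The class `Ψ` of weights is `(w', w)`-created (for `w' ≤ w`): for each small `Ψ`-limit sketch
`𝒮` and each `Ψ`-complete `ℱ`-category `C`, the `ℱ`-category of models of `𝒮` in `C` is
`Ψ`-complete, and the evaluation `ℱ`-functors preserve and jointly reflect `Ψ`-limits. -/
def IsCreated (w' w : Weakness) (Ψ : Set Weight.{u}) : Prop :=
  ∀ (𝒮 : Sketch.{u, u}) (C : Type v) [FCategory.{u} C],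
    𝒮.IsLimitSketch Ψ → IsComplete Ψ C →
      IsComplete Ψ (Mod w' w 𝒮 (.ofFCategory C)) ∧
      (∀ a : 𝒮.carrier, PreservesLimits Ψ
        (FunOn.eval w' w (fun M : Model 𝒮 (.ofFCategory C) => M.1) a)) ∧
      JointlyReflectLimits Ψ
        (fun a : 𝒮.carrier => FunOn.eval w' w (fun M : Model 𝒮 (.ofFCategory C) => M.1) a)

end Enhanced

namespace Enhanced

/-! Limits of models are computed pointwise. Let `D` be a diagram of models with weight in `Ψ`, and
choose a limit `X a` of each diagram `D(-)(a)` in the complete `ℱ`-category. The decisive point is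
that the transformations `D g` are strict, meaning that all their structure 2-cells are identities.
For `w = s` this is automatic. For a tight weight the indexing `ℱ`-category is chordate, so `D g` is
tight, and a tight `(s, w)`-transformation has identity structure 2-cells.

Because the `D g` are strict, the projections from `X a` followed by the actions of a 1-cell `f : a
⟶ b` form a cone over `D(-)(b)`. The universal property of `X b` then yields an `ℱ`-functor `M`
(`exists_pointwiseCone`). It is a model because limits commute with limits
(`PointwiseCone.isLimit_map`), and by construction its projections are strict transformations, which
form a cone of models (`TransTheory.exists_cone`).

That cone is a limit by `TransTheory.isLimit_of_ev`. Given another cone, its components at `a` lift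
to 1-cells into `X a`. Its structure 2-cells also lift, by the two-dimensional universal property,
because composing with a strict projection merely whiskers a structure 2-cell. All axioms, and the
condition of being a `w`-cell, are detected by the projections. A tight lift must moreover have
identity structure 2-cells, while the hypothesis concerns only the tight part of `W(j)`. Hence
either `w = s`, or the tight part must be everything.

The same recognition theorem gives joint reflection. Preservation follows since any limit cone is
tightly isomorphic to the pointwise one (`LooseCone.IsLimit.map_of_isLimit`).

Two devices shorten the work. A `Cell` carries its boundary, so equations in a strict 2-category
need no transport. A `TransTheory` axiomatizes an `ℱ`-category of transformations with an
orientation, so that one argument covers the lax and the colax case. -/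

/-! ## The calculus of 2-cells with boundary

In a strict 2-category, the horizontal composition of 2-cells is strictly associative and unital
once 2-cells are considered together with their boundary. -/

/-- A 2-cell together with its boundary. -/
structure Cell {K : Type v} [FCategory.{u} K] (X Y : K) where
  cell ::
  {src : X ⟶ Y}
  {tgt : X ⟶ Y}
  hom : src ⟶ tgt

namespace Cell

section Calculus

variable {K : Type v} [FCategory.{u} K] {X Y Z T : K}

lemma cell_injective {f g : X ⟶ Y} {α β : f ⟶ g} (h : cell α = cell β) : α = β := by
  injection h

/-- Transport along an equality of 1-cells is invisible once the boundary is bundled. With its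
mirror image, this is what removes associators and unitors from the calculations. -/
lemma cell_eqToHom_comp {f g h : X ⟶ Y} (p : f = g) (α : g ⟶ h) :
    cell (eqToHom p ≫ α) = cell α := by
  subst p; simp

lemma cell_comp_eqToHom {f g h : X ⟶ Y} (p : g = h) (α : f ⟶ g) :
    cell (α ≫ eqToHom p) = cell α := by
  subst p; simp

lemma cell_inv {f g f' g' : X ⟶ Y} {α : f ⟶ g} {β : f' ⟶ g'} [IsIso α] [IsIso β]
    (h : cell α = cell β) : cell (inv α) = cell (inv β) := by
  injection h with hs ht h
  subst hs ht
  obtain rfl := eq_of_heq h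
  rfl

/-- Identity 2-cells. -/
def one (f : X ⟶ Y) : Cell X Y := cell (𝟙 f)

lemma cell_id (f : X ⟶ Y) : cell (𝟙 f) = one f := rfl

@[simp] lemma one_src (f : X ⟶ Y) : (one f).src = f := rfl
@[simp] lemma one_tgt (f : X ⟶ Y) : (one f).tgt = f := rfl
lemma cell_src {f g : X ⟶ Y} (α : f ⟶ g) : (cell α).src = f := rfl
lemma cell_tgt {f g : X ⟶ Y} (α : f ⟶ g) : (cell α).tgt = g := rfl

lemma one_injective {f g : X ⟶ Y} (h : one f = one g) : f = g := congrArg src h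

lemma cell_eqToHom {f g : X ⟶ Y} (h : f = g) : cell (eqToHom h) = one f := by
  subst h; rfl

lemma exists_hom (c : Cell X Y) {f g : X ⟶ Y} (hs : c.src = f) (ht : c.tgt = g) :
    ∃ α : f ⟶ g, cell α = c := by
  subst hs ht; exact ⟨c.hom, rfl⟩

/-- The way back from bundled cells to equations between 2-cells with `eqToHom`, as in the fields of
`LooseCone`. -/
lemma eq_eqToHom_comp {f g f' g' : X ⟶ Y} {α : f ⟶ g} {β : f' ⟶ g'} (h : cell α = cell β)
    (hs : f = f') (ht : g' = g) : α = eqToHom hs ≫ β ≫ eqToHom ht := by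
  subst hs ht
  simpa using cell_injective h

/-- Horizontal composition. -/
def hcomp (a : Cell X Y) (b : Cell Y Z) : Cell X Z := cell (a.hom ▷ b.src ≫ a.tgt ◁ b.hom)

infixr:80 " ⋆ " => hcomp

@[simp] lemma hcomp_src (a : Cell X Y) (b : Cell Y Z) : (a ⋆ b).src = a.src ≫ b.src := rfl
@[simp] lemma hcomp_tgt (a : Cell X Y) (b : Cell Y Z) : (a ⋆ b).tgt = a.tgt ≫ b.tgt := rfl

lemma cell_whiskerLeft (f : X ⟶ Y) {g h : Y ⟶ Z} (α : g ⟶ h) :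
    cell (f ◁ α) = one f ⋆ cell α := by
  simp [hcomp, one]

lemma cell_whiskerRight {f g : X ⟶ Y} (α : f ⟶ g) (h : Y ⟶ Z) :
    cell (α ▷ h) = cell α ⋆ one h := by
  simp [hcomp, one]

lemma one_comp (f : X ⟶ Y) (g : Y ⟶ Z) : one (f ≫ g) = one f ⋆ one g := by
  simp [hcomp, one]

/-- In any bicategory the two sides agree up to associators. In a strict one these are `eqToHom`s,
which `cell` absorbs. -/
lemma hcomp_assoc (a : Cell X Y) (b : Cell Y Z) (c : Cell Z T) : (a ⋆ b) ⋆ c = a ⋆ (b ⋆ c) := by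
  obtain ⟨α⟩ := a
  obtain ⟨β⟩ := b
  obtain ⟨γ⟩ := c
  have : ((α ▷ _ ≫ _ ◁ β) ▷ _ ≫ _ ◁ γ) = (α_ _ _ _).hom ≫
      (α ▷ _ ≫ _ ◁ (β ▷ _ ≫ _ ◁ γ)) ≫ (α_ _ _ _).inv := by
    simp
  rw [hcomp, hcomp]
  dsimp only [hcomp]
  rw [this, Strict.associator_eqToIso, Strict.associator_eqToIso, eqToIso.hom, eqToIso.inv,
    cell_eqToHom_comp, cell_comp_eqToHom]

lemma one_id_hcomp (a : Cell X Y) : one (𝟙 X) ⋆ a = a := by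
  obtain ⟨α⟩ := a
  have : 𝟙 X ◁ α = (λ_ _).hom ≫ α ≫ (λ_ _).inv := by simp
  rw [← cell_whiskerLeft, this, Strict.leftUnitor_eqToIso, Strict.leftUnitor_eqToIso, eqToIso.hom,
    eqToIso.inv, cell_eqToHom_comp, cell_comp_eqToHom]

lemma hcomp_one_id (a : Cell X Y) : a ⋆ one (𝟙 Y) = a := by
  obtain ⟨α⟩ := a
  have : α ▷ 𝟙 Y = (ρ_ _).hom ≫ α ≫ (ρ_ _).inv := by simp
  rw [← cell_whiskerRight, this, Strict.rightUnitor_eqToIso, Strict.rightUnitor_eqToIso,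
    eqToIso.hom, eqToIso.inv, cell_eqToHom_comp, cell_comp_eqToHom]

/-- `c` is the vertical composite of `a` and `b`. -/
inductive VComp : Cell X Y → Cell X Y → Cell X Y → Prop
  | mk {f g h : X ⟶ Y} (α : f ⟶ g) (β : g ⟶ h) : VComp (cell α) (cell β) (cell (α ≫ β))

namespace VComp

variable {a b c c' : Cell X Y}

lemma src_eq (h : VComp a b c) : c.src = a.src := by cases h; rfl
lemma tgt_eq (h : VComp a b c) : c.tgt = b.tgt := by cases h; rfl
lemma mid_eq (h : VComp a b c) : a.tgt = b.src := by cases h; rfl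

/-- Composability is only a propositional equality of boundaries. This is why vertical composition
is treated as a functional relation and not as an operation. -/
lemma exists_of_eq (h : a.tgt = b.src) : ∃ c, VComp a b c := by
  obtain ⟨α⟩ := a
  obtain ⟨β⟩ := b
  obtain rfl := h
  exact ⟨_, mk α β⟩

lemma unique (h : VComp a b c) (h' : VComp a b c') : c = c' := by
  cases h; cases h'; rfl

lemma cell_iff {f g h : X ⟶ Y} {α : f ⟶ g} {β : g ⟶ h} {γ : f ⟶ h} :
    VComp (cell α) (cell β) (cell γ) ↔ α ≫ β = γ := by
  constructor
  · intro H
    exact cell_injective (unique (mk α β) H)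
  · rintro rfl
    exact mk α β

lemma whiskerRight (h : VComp a b c) (k : Y ⟶ Z) : VComp (a ⋆ one k) (b ⋆ one k) (c ⋆ one k) := by
  cases h with
  | mk α β =>
    rw [← cell_whiskerRight, ← cell_whiskerRight, ← cell_whiskerRight,
      Bicategory.comp_whiskerRight]
    exact mk _ _

lemma one_left (a : Cell X Y) : VComp (one a.src) a a := by
  obtain ⟨α⟩ := a
  simpa [one] using mk (𝟙 _) α

lemma one_right (a : Cell X Y) : VComp a (one a.tgt) a := by
  obtain ⟨α⟩ := a
  simpa [one] using mk α (𝟙 _)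

lemma eq_of_one_left {k : X ⟶ Y} (h : VComp (one k) b c) : b = c := by
  cases h; simp

lemma eq_of_one_right {k : X ⟶ Y} (h : VComp a (one k) c) : a = c := by
  cases h; simp

lemma hcomp (a : Cell X Y) (b : Cell Y Z) : VComp (a ⋆ one b.src) (one a.tgt ⋆ b) (a ⋆ b) := by
  obtain ⟨α⟩ := a
  obtain ⟨β⟩ := b
  rw [← cell_whiskerLeft, ← cell_whiskerRight]
  exact mk _ _

lemma hcomp' (a : Cell X Y) (b : Cell Y Z) : VComp (one a.src ⋆ b) (a ⋆ one b.tgt) (a ⋆ b) := by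
  obtain ⟨α⟩ := a
  obtain ⟨β⟩ := b
  rw [← cell_whiskerLeft, ← cell_whiskerRight, Cell.hcomp, ← whisker_exchange]
  exact mk _ _

end VComp

/-- The vertical composites of `a` and `b` and of `a'` and `b'` exist and coincide. -/
def Sq (a b a' b' : Cell X Y) : Prop := ∃ c, VComp a b c ∧ VComp a' b' c

namespace Sq

variable {a b a' b' : Cell X Y}

lemma cell_iff {f g g' h : X ⟶ Y} {α : f ⟶ g} {β : g ⟶ h} {α' : f ⟶ g'} {β' : g' ⟶ h} :
    Sq (cell α) (cell β) (cell α') (cell β') ↔ α ≫ β = α' ≫ β' := by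
  constructor
  · rintro ⟨c, h, h'⟩
    obtain rfl := (VComp.mk α β).unique h
    exact (VComp.cell_iff.1 h').symm
  · intro h
    exact ⟨_, VComp.mk α β, h ▸ VComp.mk α' β'⟩

lemma symm (h : Sq a b a' b') : Sq a' b' a b := ⟨_, h.choose_spec.2, h.choose_spec.1⟩

lemma whiskerRight (h : Sq a b a' b') (k : Y ⟶ Z) :
    Sq (a ⋆ one k) (b ⋆ one k) (a' ⋆ one k) (b' ⋆ one k) :=
  ⟨_, h.choose_spec.1.whiskerRight k, h.choose_spec.2.whiskerRight k⟩

lemma interchange (a : Cell X Y) (b : Cell Y Z) :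
    Sq (a ⋆ one b.src) (one a.tgt ⋆ b) (one a.src ⋆ b) (a ⋆ one b.tgt) :=
  ⟨_, VComp.hcomp a b, VComp.hcomp' a b⟩

/-- Composing with an identity on either side changes nothing. In this way naturality squares become
equations when the structure 2-cells are identities. -/
lemma eq_of_one {k k' : X ⟶ Y} (h : Sq a (one k) (one k') b') : a = b' := by
  obtain ⟨c, h, h'⟩ := h
  exact h.eq_of_one_right.trans h'.eq_of_one_left.symm

lemma of_eq_one (a : Cell X Y) : Sq a (one a.tgt) (one a.src) a :=
  ⟨_, VComp.one_right a, VComp.one_left a⟩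

end Sq

/-- `c` is a `w`-cell. -/
def Is (w : Weakness) (c : Cell X Y) : Prop := w.IsCell c.hom

lemma is_one (w : Weakness) (f : X ⟶ Y) : (one f).Is w := w.isCell_eqToHom (rfl : f = f)

lemma is_s_iff {c : Cell X Y} : c.Is .s ↔ c = one c.src := by
  obtain ⟨α⟩ := c
  constructor
  · rintro ⟨h, hα⟩
    dsimp only at h hα
    rw [hα, cell_eqToHom]; rfl
  · intro h
    rw [h]
    exact is_one _ _

lemma Is.whiskerLeft {w : Weakness} {c : Cell X Y} (h : c.Is w) (k : T ⟶ X) :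
    (one k ⋆ c).Is w := by
  obtain ⟨α⟩ := c
  rw [← cell_whiskerLeft]
  exact w.isCell_map (precomp _ k) h

lemma Is.whiskerRight {w : Weakness} {c : Cell X Y} (h : c.Is w) (k : Y ⟶ Z) :
    (c ⋆ one k).Is w := by
  obtain ⟨α⟩ := c
  rw [← cell_whiskerRight]
  exact w.isCell_map (postcomp _ k) h

end Calculus

end Cell

/-! ### The action of `ℱ`-functors on 2-cells with boundary. -/

namespace FFunctor

open Cell

variable {K : Type v₁} [FCategory.{u} K] {L : Type v₂} [FCategory.{u} L]

/-- The action of an `ℱ`-functor on 2-cells with boundary. -/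
def mapCell (F : FFunctor K L) {X Y : K} (a : Cell X Y) : Cell (F.obj X) (F.obj Y) :=
  cell (F.map₂ a.hom)

variable (F : FFunctor K L) {X Y Z : K}

lemma mapCell_cell {f g : X ⟶ Y} (α : f ⟶ g) : F.mapCell (cell α) = cell (F.map₂ α) := rfl

lemma mapCell_one (f : X ⟶ Y) : F.mapCell (one f) = one (F.map f) := by
  rw [one, mapCell_cell, F.map₂_id]; rfl

lemma mapCell_hcomp (a : Cell X Y) (b : Cell Y Z) :
    F.mapCell (a ⋆ b) = F.mapCell a ⋆ F.mapCell b := by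
  obtain ⟨α⟩ := a
  obtain ⟨β⟩ := b
  rw [hcomp, mapCell_cell, F.map₂_comp, F.map₂_whiskerLeft', F.map₂_whiskerRight']
  simp only [Category.assoc, eqToHom_trans_assoc, eqToHom_refl, Category.id_comp]
  rw [cell_eqToHom_comp, ← Category.assoc, cell_comp_eqToHom]
  rfl

lemma mapCell_vcomp {a b c : Cell X Y} (h : VComp a b c) :
    VComp (F.mapCell a) (F.mapCell b) (F.mapCell c) := by
  cases h with
  | mk α β =>
    rw [mapCell_cell, mapCell_cell, mapCell_cell, F.map₂_comp]
    exact .mk _ _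

/-- An `ℱ`-functor constructed from a functorial action on 2-cells with boundary. -/
@[simps obj map map₂]
def ofCell (obj : K → L) (map : ∀ {X Y : K}, (X ⟶ Y) → (obj X ⟶ obj Y))
    (map₂ : ∀ {X Y : K} {f g : X ⟶ Y}, (f ⟶ g) → (map f ⟶ map g))
    (map₂_id : ∀ {X Y : K} (f : X ⟶ Y), map₂ (𝟙 f) = 𝟙 (map f))
    (map₂_comp : ∀ {X Y : K} {f g h : X ⟶ Y} (α : f ⟶ g) (β : g ⟶ h),
      map₂ (α ≫ β) = map₂ α ≫ map₂ β)
    (map_id : ∀ X, map (𝟙 X) = 𝟙 (obj X))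
    (map_comp : ∀ {X Y Z : K} (f : X ⟶ Y) (g : Y ⟶ Z), map (f ≫ g) = map f ≫ map g)
    (map₂_whiskerLeft : ∀ {X Y Z : K} (f : X ⟶ Y) {g h : Y ⟶ Z} (α : g ⟶ h),
      cell (map₂ (f ◁ α)) = one (map f) ⋆ cell (map₂ α))
    (map₂_whiskerRight : ∀ {X Y Z : K} {f g : X ⟶ Y} (α : f ⟶ g) (h : Y ⟶ Z),
      cell (map₂ (α ▷ h)) = cell (map₂ α) ⋆ one (map h))
    (map_tight : ∀ {X Y : K} {f : X ⟶ Y}, FCategory.IsTight f → FCategory.IsTight (map f)) :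
    FFunctor K L :=
  have map₂_eqToHom {X Y : K} {f g : X ⟶ Y} (h : f = g) :
      map₂ (eqToHom h) = eqToHom (congrArg map h) := by
    subst h; exact map₂_id _
  { obj := obj
    map := map
    map₂ := map₂
    map₂_id := map₂_id
    map₂_comp := map₂_comp
    mapId X := eqToHom (map_id X).symm
    mapComp f g := eqToHom (map_comp f g).symm
    mapComp_naturality_left {X Y Z f g} α h := by
      apply cell_injective
      rw [cell_eqToHom_comp, cell_comp_eqToHom, map₂_whiskerRight, cell_whiskerRight]
    mapComp_naturality_right {X Y Z} f {g h} α := by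
      apply cell_injective
      rw [cell_eqToHom_comp, cell_comp_eqToHom, map₂_whiskerLeft, cell_whiskerLeft]
    map₂_associator f g h := by
      simp only [Strict.associator_eqToIso, eqToIso.hom, map₂_eqToHom, eqToHom_whiskerRight,
        whiskerLeft_eqToHom, eqToHom_trans]
    map₂_leftUnitor f := by
      simp only [Strict.leftUnitor_eqToIso, eqToIso.inv, map₂_eqToHom, eqToHom_whiskerRight,
        eqToHom_trans]
    map₂_rightUnitor f := by
      simp only [Strict.rightUnitor_eqToIso, eqToIso.inv, map₂_eqToHom, whiskerLeft_eqToHom,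
        eqToHom_trans]
    map_id := map_id
    mapId_eq _ := rfl
    map_comp := map_comp
    mapComp_eq _ _ := rfl
    map_tight := map_tight }

end FFunctor

open Cell

section ConeCells

/-! ## Cones in terms of 2-cells with boundary -/

variable {J : Type u} [FCategory.{u} J] {K : Type v₁} [FCategory.{u} K]
  {L : Type v₂} [FCategory.{u} L]

namespace LooseCone

variable {W : FFunctor J BbF.{u}} {D : FFunctor J K} {X Z : K}

lemma one_naturality (γ : LooseCone W D X) {i j : J} (f : i ⟶ j) (y : wObj W i) :
    one ((γ.proj j).obj ((wMap W f).obj y)) = one ((γ.proj i).obj y) ⋆ one (D.map f) := by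
  rw [γ.naturality_obj, one_comp]

lemma cell_naturality (γ : LooseCone W D X) {i j : J} (f : i ⟶ j) {y z : wObj W i} (t : y ⟶ z) :
    cell ((γ.proj j).map ((wMap W f).map t)) =
      cell ((γ.proj i).map t) ⋆ one (D.map f) := by
  rw [γ.naturality_map, cell_eqToHom_comp, cell_comp_eqToHom, cell_whiskerRight]

lemma cell_naturality₂ (γ : LooseCone W D X) {i j : J} {f g : i ⟶ j} (α : f ⟶ g) (y : wObj W i) :
    cell ((γ.proj j).map ((wMap₂ W α).app y)) =
      one ((γ.proj i).obj y) ⋆ cell (D.map₂ α) := by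
  rw [γ.naturality₂, cell_eqToHom_comp, cell_comp_eqToHom, cell_whiskerLeft]

/-- A cone from a family of functors that is natural on 2-cells with boundary. -/
@[simps proj]
def ofCell (proj : ∀ j : J, wObj W j ⥤ (X ⟶ D.obj j))
    (nat : ∀ {i j : J} (f : i ⟶ j) {y z : wObj W i} (t : y ⟶ z),
      cell ((proj j).map ((wMap W f).map t)) = cell ((proj i).map t) ⋆ one (D.map f))
    (nat₂ : ∀ {i j : J} {f g : i ⟶ j} (α : f ⟶ g) (y : wObj W i),
      cell ((proj j).map ((wMap₂ W α).app y)) = one ((proj i).obj y) ⋆ cell (D.map₂ α)) :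
    LooseCone W D X where
  proj := proj
  naturality_obj f y := congrArg Cell.src (nat f (𝟙 y))
  naturality_map f _ _ t := eq_eqToHom_comp ((nat f t).trans (cell_whiskerRight _ _).symm) _ _
  naturality₂ α y := eq_eqToHom_comp ((nat₂ α y).trans (cell_whiskerLeft _ _).symm) _ _

/-- Morphisms suffice, since the bundled image of an identity records the value on the object. -/
lemma functor_ext {A : Type v₃} [Category.{v₄} A] {Y : K} {F G : A ⥤ (X ⟶ Y)}
    (h : ∀ {y z : A} (t : y ⟶ z), cell (F.map t) = cell (G.map t)) : F = G :=
  CategoryTheory.Functor.ext (fun y => congrArg Cell.src (h (𝟙 y)))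
    fun _ _ t => eq_eqToHom_comp (h t) _ _

lemma ext_cell {γ δ : LooseCone W D X}
    (h : ∀ (j : J) {y z : wObj W j} (t : y ⟶ z),
      cell ((γ.proj j).map t) = cell ((δ.proj j).map t)) : γ = δ := by
  obtain ⟨p, _, _, _⟩ := γ
  obtain ⟨q, _, _, _⟩ := δ
  obtain rfl : p = q := funext fun j => functor_ext (h j)
  rfl

lemma Hom.cell_naturality {γ δ : LooseCone W D X} (Γ : γ ⟶ δ) {i j : J} (f : i ⟶ j)
    (y : wObj W i) :
    cell ((Hom.app Γ j).app ((wMap W f).obj y)) = cell ((Hom.app Γ i).app y) ⋆ one (D.map f) := by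
  rw [Hom.naturality, cell_eqToHom_comp, cell_comp_eqToHom, cell_whiskerRight]

/-- A morphism of cones from a family of 2-cells with boundary. -/
lemma exists_hom {γ δ : LooseCone W D X} (c : ∀ j, wObj W j → Cell X (D.obj j))
    (hs : ∀ j y, (c j y).src = (γ.proj j).obj y) (ht : ∀ j y, (c j y).tgt = (δ.proj j).obj y)
    (nat : ∀ (j : J) {y z : wObj W j} (t : y ⟶ z),
      Sq (cell ((γ.proj j).map t)) (c j z) (c j y) (cell ((δ.proj j).map t)))
    (nat' : ∀ {i j : J} (f : i ⟶ j) (y : wObj W i),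
      c j ((wMap W f).obj y) = c i y ⋆ one (D.map f)) :
    ∃ Γ : γ ⟶ δ, ∀ j y, cell ((Hom.app Γ j).app y) = c j y := by
  choose a ha using fun j y => (c j y).exists_hom (hs j y) (ht j y)
  refine ⟨{ app j := { app := a j, naturality y z t := ?_ }, naturality f y := ?_ }, ha⟩
  · rw [← Sq.cell_iff, ha, ha]
    exact nat j t
  · refine eq_eqToHom_comp ?_ _ _
    rw [cell_whiskerRight, ha, ha]
    exact nat' f y

/-! ### The universal property of a limit, for 2-cells with boundary. -/

namespace IsLimit

variable {γ : LooseCone W D X} (hγ : γ.IsLimit)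
include hγ

lemma hom_ext {f g : Z ⟶ X} (h : ∀ (j : J) {y z : wObj W j} (t : y ⟶ z),
    one f ⋆ cell ((γ.proj j).map t) = one g ⋆ cell ((γ.proj j).map t)) : f = g :=
  (hγ.bijective Z).1 <| show γ.precompose f = γ.precompose g from ext_cell fun j _ _ t =>
    (cell_whiskerLeft _ _).trans ((h j t).trans (cell_whiskerLeft _ _).symm)

lemma exists_lift (δ : LooseCone W D Z) :
    ∃ f : Z ⟶ X, ∀ (j : J) {y z : wObj W j} (t : y ⟶ z),
      one f ⋆ cell ((γ.proj j).map t) = cell ((δ.proj j).map t) := by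
  obtain ⟨f, rfl⟩ := (hγ.bijective Z).2 δ
  exact ⟨f, fun j y z t => (cell_whiskerLeft _ _).symm⟩

lemma hom₂_ext {f g : Z ⟶ X} {α β : f ⟶ g} (h : ∀ (j : J) (y : wObj W j),
    cell α ⋆ one ((γ.proj j).obj y) = cell β ⋆ one ((γ.proj j).obj y)) : α = β :=
  (hγ.faithful Z).map_injective (LooseCone.hom_ext fun j => by
    ext y
    exact cell_injective
      ((cell_whiskerRight _ _).trans ((h j y).trans (cell_whiskerRight _ _).symm)))

/-- Faithfulness of the comparison functor concerns parallel 2-cells, so the boundaries have to be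
matched beforehand. -/
lemma cell_ext {a b : Cell Z X} (hs : a.src = b.src) (ht : a.tgt = b.tgt)
    (h : ∀ (j : J) (y : wObj W j), a ⋆ one ((γ.proj j).obj y) = b ⋆ one ((γ.proj j).obj y)) :
    a = b := by
  obtain ⟨α⟩ := a
  obtain ⟨β⟩ := b
  obtain rfl := hs
  obtain rfl := ht
  rw [hγ.hom₂_ext h]

/-- Fullness of the comparison functor, for a family of bundled cells whose boundaries need only be
propositionally correct. -/
lemma exists_lift₂ (f g : Z ⟶ X) (c : ∀ j, wObj W j → Cell Z (D.obj j))
    (hs : ∀ j y, (c j y).src = f ≫ (γ.proj j).obj y)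
    (ht : ∀ j y, (c j y).tgt = g ≫ (γ.proj j).obj y)
    (nat : ∀ (j : J) {y z : wObj W j} (t : y ⟶ z),
      Sq (one f ⋆ cell ((γ.proj j).map t)) (c j z) (c j y) (one g ⋆ cell ((γ.proj j).map t)))
    (nat' : ∀ {i j : J} (f : i ⟶ j) (y : wObj W i),
      c j ((wMap W f).obj y) = c i y ⋆ one (D.map f)) :
    ∃ α : f ⟶ g, ∀ j y, cell α ⋆ one ((γ.proj j).obj y) = c j y := by
  obtain ⟨Γ, hΓ⟩ := exists_hom (γ := γ.precompose f) (δ := γ.precompose g) c hs ht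
    (fun j y z t => by
      have := nat j t
      rw [← cell_whiskerLeft, ← cell_whiskerLeft] at this
      exact this) nat'
  obtain ⟨α, rfl⟩ := (hγ.full Z).map_surjective Γ
  exact ⟨α, fun j y => (cell_whiskerRight _ _).symm.trans (hΓ j y)⟩

/-- The composite of `a` and `b` exists by `hm`; it has the same boundary as `c` and the same
whiskerings with the projections, so it is `c`. -/
lemma vcomp_ext {a b c : Cell Z X} (hs : c.src = a.src) (ht : c.tgt = b.tgt)
    (hm : a.tgt = b.src)
    (h : ∀ (j : J) (y : wObj W j), VComp (a ⋆ one ((γ.proj j).obj y))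
      (b ⋆ one ((γ.proj j).obj y)) (c ⋆ one ((γ.proj j).obj y))) : VComp a b c := by
  obtain ⟨d, hd⟩ := VComp.exists_of_eq hm
  rwa [hγ.cell_ext (hs.trans hd.src_eq.symm) (ht.trans hd.tgt_eq.symm)
    fun j y => (h j y).unique (hd.whiskerRight _)]

lemma sq_ext {a b a' b' : Cell Z X} (hs : a.src = a'.src) (ht : b.tgt = b'.tgt)
    (hm : a.tgt = b.src) (hm' : a'.tgt = b'.src)
    (h : ∀ (j : J) (y : wObj W j), Sq (a ⋆ one ((γ.proj j).obj y))
      (b ⋆ one ((γ.proj j).obj y)) (a' ⋆ one ((γ.proj j).obj y))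
      (b' ⋆ one ((γ.proj j).obj y))) : Sq a b a' b' := by
  obtain ⟨d, hd⟩ := VComp.exists_of_eq hm
  refine ⟨d, hd, hγ.vcomp_ext (hd.src_eq.trans hs) (hd.tgt_eq.trans ht) hm' fun j y => ?_⟩
  obtain ⟨c, hc, hc'⟩ := h j y
  rwa [← hc.unique (hd.whiskerRight _)]

lemma isTight_iff (f : Z ⟶ X) : FCategory.IsTight f ↔
    ∀ (j : J) (y : FullEmb.tight (W.obj j)),
      FCategory.IsTight (f ≫ (γ.proj j).obj ((FullEmb.incl (W.obj j)).obj y)) :=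
  hγ.tight_iff f

/-- A 2-cell into a limit is a `w`-cell when its composites with the projections are. -/
lemma is_ext {w : Weakness} {a : Cell Z X}
    (h : ∀ (j : J) (y : wObj W j), (a ⋆ one ((γ.proj j).obj y)).Is w) : a.Is w := by
  obtain @⟨f, g, α⟩ := a
  cases w with
  | s =>
    have h' (j : J) (y : wObj W j) := is_s_iff.1 (h j y)
    -- Agreement is needed also on the morphisms `t` of the weight. In the interchange square of `α`
    -- with the image of `t`, the two sides that whisker `α` are identities, so the other two
    -- coincide.
    obtain rfl : f = g := hγ.hom_ext fun j y z t => by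
      obtain ⟨c, hc, hc'⟩ := Sq.interchange (cell α) (cell ((γ.proj j).map t))
      rw [cell_src, h'] at hc
      rw [cell_tgt, h'] at hc'
      exact hc'.eq_of_one_right.trans hc.eq_of_one_left.symm
    rw [is_s_iff]
    refine hγ.cell_ext rfl rfl fun j y => ?_
    rw [h', ← one_comp]
    rfl
  | p =>
    have h₁ (j : J) (y : wObj W j) : IsIso (α ▷ (γ.proj j).obj y) := by
      have := h j y
      rwa [← cell_whiskerRight] at this
    -- The inverses of the whiskered 2-cells again form a modification. Its lift `β` is the inverse
    -- of `α`.
    obtain ⟨β, hβ⟩ := hγ.exists_lift₂ g f (fun j y => cell (inv (α ▷ (γ.proj j).obj y)))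
      (fun _ _ => rfl) (fun _ _ => rfl)
      (fun j y z t => by
        rw [← cell_whiskerLeft, ← cell_whiskerLeft, Sq.cell_iff, IsIso.comp_inv_eq,
          Category.assoc, IsIso.eq_inv_comp]
        exact (whisker_exchange α ((γ.proj j).map t)).symm)
      (fun {i j} k y => by
        rw [← cell_whiskerRight, ← inv_whiskerRight]
        apply cell_inv
        rw [cell_whiskerRight, cell_whiskerRight, cell_whiskerRight, hcomp_assoc,
          one_naturality])
    refine ⟨β, hγ.hom₂_ext fun j y => ?_, hγ.hom₂_ext fun j y => ?_⟩
    · have e := VComp.mk (α ▷ (γ.proj j).obj y) (inv (α ▷ (γ.proj j).obj y))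
      rw [← hβ, IsIso.hom_inv_id, cell_whiskerRight] at e
      exact (((VComp.mk α β).whiskerRight _).unique e).trans (one_comp _ _)
    · have e := VComp.mk (inv (α ▷ (γ.proj j).obj y)) (α ▷ (γ.proj j).obj y)
      rw [← hβ, IsIso.inv_hom_id, cell_whiskerRight] at e
      exact (((VComp.mk β α).whiskerRight _).unique e).trans (one_comp _ _)
  | l => trivial
  | c => trivial

/-- The universal property of a limit with respect to families of cones. -/
lemma exists_lift_functor {A : Type v₃} [Category.{v₄} A]
    (H : ∀ j : J, wObj W j ⥤ A ⥤ (Z ⟶ D.obj j))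
    (nat : ∀ {i j : J} (f : i ⟶ j) {y z : wObj W i} (t : y ⟶ z) (k : A),
      cell (((H j).map ((wMap W f).map t)).app k) =
        cell (((H i).map t).app k) ⋆ one (D.map f))
    (nat' : ∀ {i j : J} (f : i ⟶ j) (y : wObj W i) {k l : A} (s : k ⟶ l),
      cell (((H j).obj ((wMap W f).obj y)).map s) = cell (((H i).obj y).map s) ⋆ one (D.map f))
    (nat₂ : ∀ {i j : J} {f g : i ⟶ j} (α : f ⟶ g) (y : wObj W i) (k : A),
      cell (((H j).map ((wMap₂ W α).app y)).app k) =
        one (((H i).obj y).obj k) ⋆ cell (D.map₂ α)) :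
    ∃ F : A ⥤ (Z ⟶ X),
      (∀ (j : J) {y z : wObj W j} (t : y ⟶ z) (k : A),
        one (F.obj k) ⋆ cell ((γ.proj j).map t) = cell (((H j).map t).app k)) ∧
      ∀ (j : J) (y : wObj W j) {k l : A} (s : k ⟶ l),
        cell (F.map s) ⋆ one ((γ.proj j).obj y) = cell (((H j).obj y).map s) := by
  -- Objects of `A` use the one-dimensional universal property and morphisms the two-dimensional
  -- one. Functoriality then follows from uniqueness.
  choose f hf using fun k : A => hγ.exists_lift (LooseCone.ofCell
    (fun j => H j ⋙ (CategoryTheory.evaluation A _).obj k) (fun g y z t => nat g t k)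
    (fun α y => nat₂ α y k))
  have hf' (k : A) (j : J) (y : wObj W j) :
      f k ≫ (γ.proj j).obj y = ((H j).obj y).obj k :=
    congrArg Cell.src (hf k j (𝟙 y))
  choose m hm using fun (k l : A) (s : k ⟶ l) => hγ.exists_lift₂ (f k) (f l)
    (fun j y => cell (((H j).obj y).map s)) (fun j y => (hf' k j y).symm)
    (fun j y => (hf' l j y).symm)
    (fun j y z t => by
      rw [hf, hf]
      exact Sq.cell_iff.2 (((H j).map t).naturality s).symm)
    (fun g y => nat' g y s)
  refine ⟨{ obj := f, map {k l} s := m k l s, map_id k := ?_, map_comp {k l n} s t := ?_ },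
    fun j y z t k => hf k j t, fun j y k l s => hm k l s j y⟩
  · refine hγ.hom₂_ext fun j y => ?_
    rw [hm, CategoryTheory.Functor.map_id, cell_id, cell_id, ← one_comp, hf']
  · refine Eq.symm (VComp.cell_iff.1 ?_)
    refine hγ.vcomp_ext rfl rfl rfl fun j y => ?_
    rw [hm, hm, hm, CategoryTheory.Functor.map_comp]
    exact .mk _ _

end IsLimit

/-- Recognition of limit cones. -/
lemma isLimit_of {γ : LooseCone W D X}
    (hom_ext : ∀ {Z : K} {f g : Z ⟶ X}, (∀ (j : J) {y z : wObj W j} (t : y ⟶ z),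
      one f ⋆ cell ((γ.proj j).map t) = one g ⋆ cell ((γ.proj j).map t)) → f = g)
    (exists_lift : ∀ {Z : K} (δ : LooseCone W D Z),
      ∃ f : Z ⟶ X, ∀ (j : J) {y z : wObj W j} (t : y ⟶ z),
        one f ⋆ cell ((γ.proj j).map t) = cell ((δ.proj j).map t))
    (hom₂_ext : ∀ {Z : K} {f g : Z ⟶ X} {α β : f ⟶ g}, (∀ (j : J) (y : wObj W j),
      cell α ⋆ one ((γ.proj j).obj y) = cell β ⋆ one ((γ.proj j).obj y)) → α = β)
    (exists_lift₂ : ∀ {Z : K} {f g : Z ⟶ X}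
      (c : ∀ (j : J) (y : wObj W j), f ≫ (γ.proj j).obj y ⟶ g ≫ (γ.proj j).obj y),
      (∀ (j : J) {y z : wObj W j} (t : y ⟶ z), Sq (one f ⋆ cell ((γ.proj j).map t))
        (cell (c j z)) (cell (c j y)) (one g ⋆ cell ((γ.proj j).map t))) →
      (∀ {i j : J} (h : i ⟶ j) (y : wObj W i),
        cell (c j ((wMap W h).obj y)) = cell (c i y) ⋆ one (D.map h)) →
      ∃ α : f ⟶ g, ∀ j y, cell α ⋆ one ((γ.proj j).obj y) = cell (c j y))
    (tight_iff : ∀ {Z : K} (f : Z ⟶ X), FCategory.IsTight f ↔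
      ∀ (j : J) (y : FullEmb.tight (W.obj j)),
        FCategory.IsTight (f ≫ (γ.proj j).obj ((FullEmb.incl (W.obj j)).obj y))) :
    γ.IsLimit where
  bijective Z := by
    constructor
    · intro f g h
      refine hom_ext fun j y z t => ?_
      rw [← cell_whiskerLeft, ← cell_whiskerLeft]
      have H := congrArg (fun δ : LooseCone W D Z => cell ((δ.proj j).map t)) h
      exact H
    · intro δ
      obtain ⟨f, hf⟩ := exists_lift δ
      refine ⟨f, ext_cell fun j y z t => ?_⟩
      rw [← hf, ← cell_whiskerLeft]
      rfl
  full Z := by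
    constructor
    intro f g Γ
    obtain ⟨α, hα⟩ := exists_lift₂ (fun j => (Hom.app Γ j).app)
      (fun j y z t => by
        rw [← cell_whiskerLeft, ← cell_whiskerLeft]
        exact Sq.cell_iff.2 ((Hom.app Γ j).naturality t))
      (fun h y => Hom.cell_naturality Γ h y)
    refine ⟨α, LooseCone.hom_ext fun j => ?_⟩
    ext y
    exact cell_injective ((cell_whiskerRight _ _).trans (hα j y))
  faithful Z := by
    constructor
    intro f g α β h
    refine hom₂_ext fun j y => ?_
    rw [← cell_whiskerRight, ← cell_whiskerRight]
    have H := congrArg (fun Γ => cell ((Hom.app Γ j).app y)) h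
    exact H
  tight_iff f := tight_iff f

/-- Composing a limit cone with a tight isomorphism gives a limit cone. -/
lemma IsLimit.of_iso {γ : LooseCone W D X} (hγ : γ.IsLimit) {Y : K} {δ : LooseCone W D Y}
    (f : Y ⟶ X) (g : X ⟶ Y) (hfg : f ≫ g = 𝟙 Y) (hgf : g ≫ f = 𝟙 X) (hf : FCategory.IsTight f)
    (hg : FCategory.IsTight g)
    (h : ∀ (j : J) {y z : wObj W j} (t : y ⟶ z),
      one f ⋆ cell ((γ.proj j).map t) = cell ((δ.proj j).map t)) : δ.IsLimit := by
  have h₁ (j : J) (y : wObj W j) : one f ⋆ one ((γ.proj j).obj y) = one ((δ.proj j).obj y) := by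
    simpa only [CategoryTheory.Functor.map_id, cell_id] using h j (𝟙 y)
  have hfg' : one f ⋆ one g = one (𝟙 Y) := by rw [← one_comp, hfg]
  have hgf' : one g ⋆ one f = one (𝟙 X) := by rw [← one_comp, hgf]
  have h₀ (j : J) (y : wObj W j) : f ≫ (γ.proj j).obj y = (δ.proj j).obj y :=
    congrArg Cell.src (h₁ j y)
  have cancel {Z : K} {a b : Cell Z Y} (e : a ⋆ one f = b ⋆ one f) : a = b := by
    rw [← hcomp_one_id a, ← hcomp_one_id b, ← hfg', ← hcomp_assoc, ← hcomp_assoc, e]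
  refine isLimit_of ?_ ?_ ?_ ?_ ?_
  · intro Z k l e
    refine one_injective (cancel ?_)
    rw [← one_comp, ← one_comp]
    congr 1
    refine hγ.hom_ext fun j y z t => ?_
    rw [one_comp, one_comp, hcomp_assoc, hcomp_assoc, h, e]
  · intro Z θ
    obtain ⟨k, hk⟩ := hγ.exists_lift θ
    refine ⟨k ≫ g, fun j y z t => ?_⟩
    rw [← hk, ← h, one_comp, hcomp_assoc, ← hcomp_assoc (one g), hgf', one_id_hcomp]
  · intro Z k l α β e
    refine cell_injective (cancel (hγ.cell_ext rfl rfl fun j y => ?_))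
    rw [hcomp_assoc, hcomp_assoc, h₁, e]
  · intro Z k l c nat nat'
    obtain ⟨α, hα⟩ := hγ.exists_lift₂ (k ≫ f) (l ≫ f) (fun j y => cell (c j y))
      (fun j y => by rw [cell_src, Strict.assoc, h₀])
      (fun j y => by rw [cell_tgt, Strict.assoc, h₀])
      (fun j y z t => by
        rw [one_comp, one_comp, hcomp_assoc, hcomp_assoc, h]
        exact nat j t) nat'
    obtain ⟨β, hβ⟩ := (cell α ⋆ one g).exists_hom (f := k) (g := l)
      (by have := Strict.comp_id k; rwa [← hfg, ← Strict.assoc] at this)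
      (by have := Strict.comp_id l; rwa [← hfg, ← Strict.assoc] at this)
    refine ⟨β, fun j y => ?_⟩
    rw [hβ, ← hα, ← h₁, hcomp_assoc, ← hcomp_assoc (one g), hgf', one_id_hcomp]
  · intro Z k
    simp only [← h₀]
    simp only [← Strict.assoc]
    rw [← hγ.isTight_iff]
    constructor
    · intro hk
      exact FCategory.tight_comp hk hf
    · intro hk
      have := FCategory.tight_comp hk hg
      rwa [Strict.assoc, hfg, Strict.comp_id] at this

/-- If an `ℱ`-functor preserves one limit cone over a diagram, then it preserves all of them. -/
lemma IsLimit.map_of_isLimit {γ : LooseCone W D X} (hγ : γ.IsLimit) (tγ : γ.IsTight) {Y : K}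
    {δ : LooseCone W D Y} (hδ : δ.IsLimit) (tδ : δ.IsTight) (F : FFunctor K L)
    (hF : (γ.map F).IsLimit) : (δ.map F).IsLimit := by
  have h₁ {X Y : K} {γ : LooseCone W D X} {δ : LooseCone W D Y} {f : Y ⟶ X}
      (h : ∀ (j : J) {y z : wObj W j} (t : y ⟶ z),
        one f ⋆ cell ((γ.proj j).map t) = cell ((δ.proj j).map t)) (j : J) (y : wObj W j) :
      f ≫ (γ.proj j).obj y = (δ.proj j).obj y := by
    have := congrArg Cell.src (h j (𝟙 y))
    exact this
  obtain ⟨f, hf⟩ := hγ.exists_lift δ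
  obtain ⟨g, hg⟩ := hδ.exists_lift γ
  have hfg : f ≫ g = 𝟙 Y := hδ.hom_ext fun j y z t => by
    rw [one_comp, hcomp_assoc, hg, hf, one_id_hcomp]
  have hgf : g ≫ f = 𝟙 X := hγ.hom_ext fun j y z t => by
    rw [one_comp, hcomp_assoc, hf, hg, one_id_hcomp]
  refine hF.of_iso (F.map f) (F.map g) ?_ ?_ ?_ ?_ ?_
  · rw [← F.map_comp, hfg, F.map_id]
  · rw [← F.map_comp, hgf, F.map_id]
  -- The comparison isomorphism is tight in both directions because both cones are tight and limits
  -- detect tightness. Its image is thus a tight isomorphism, as `of_iso` requires.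
  · exact F.map_tight ((hγ.isTight_iff f).2 fun j y => by rw [h₁ hf]; exact tδ j y)
  · exact F.map_tight ((hδ.isTight_iff g).2 fun j y => by rw [h₁ hg]; exact tγ j y)
  · intro j y z t
    have := congrArg F.mapCell (hf j t)
    rwa [F.mapCell_hcomp, F.mapCell_one] at this

end LooseCone

end ConeCells

/-! ## Oriented 2-cells -/

/-- The two possible orientations of the structure 2-cells of a transformation. -/
inductive Orientation
  | lax | colax

namespace Cell

variable {K : Type v} [FCategory.{u} K] {X Y Z T : K}

/-- In the orientation `o`, the 2-cell `c` goes from `f` to `g`. -/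
def Bd (o : Orientation) (c : Cell X Y) (f g : X ⟶ Y) : Prop :=
  match o with
  | .lax => c.src = f ∧ c.tgt = g
  | .colax => c.src = g ∧ c.tgt = f

/-- The square with horizontal sides `p`, `q`, oriented by `o`, and vertical sides `u`, `v`
commutes. -/
def OSq (o : Orientation) (p q u v : Cell X Y) : Prop :=
  match o with
  | .lax => Sq p v u q
  | .colax => Sq v q p u

/-- In the orientation `o`, the 2-cell `c` is the composite of `a` and `b`. -/
def OComp (o : Orientation) (a b c : Cell X Y) : Prop :=
  match o with
  | .lax => VComp a b c
  | .colax => VComp b a c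

variable {o : Orientation} {a b c p q x y : Cell X Y} {f g h : X ⟶ Y}

lemma Bd.src_eq (hp : Bd o p f g) (hq : Bd o q f g) : p.src = q.src := by
  cases o <;> exact hp.1.trans hq.1.symm

lemma Bd.tgt_eq (hp : Bd o p f g) (hq : Bd o q f g) : p.tgt = q.tgt := by
  cases o <;> exact hp.2.trans hq.2.symm

lemma bd_one (f : X ⟶ Y) : Bd o (one f) f f := by
  cases o <;> exact ⟨rfl, rfl⟩

lemma Bd.whiskerLeft (hp : Bd o p f g) (k : T ⟶ X) : Bd o (one k ⋆ p) (k ≫ f) (k ≫ g) := by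
  cases o <;> exact ⟨congrArg (k ≫ ·) hp.1, congrArg (k ≫ ·) hp.2⟩

lemma Bd.whiskerRight (hp : Bd o p f g) (k : Y ⟶ Z) : Bd o (p ⋆ one k) (f ≫ k) (g ≫ k) := by
  cases o <;> exact ⟨congrArg (· ≫ k) hp.1, congrArg (· ≫ k) hp.2⟩

lemma Bd.eq_of_is_s (hp : Bd o p f g) (hs : p.Is .s) : f = g := by
  have e : p.src = p.tgt := by rw [is_s_iff.1 hs]; rfl
  cases o with
  | lax => exact hp.1.symm.trans (e.trans hp.2)
  | colax => exact hp.2.symm.trans (e.symm.trans hp.1)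

lemma OSq.eq_of_is_s (h : OSq o p q x y) (hp : p.Is .s) (hq : q.Is .s) : x = y := by
  rw [is_s_iff.1 hp, is_s_iff.1 hq] at h
  cases o with
  | lax => exact h.symm.eq_of_one
  | colax => exact h.eq_of_one.symm

/-- Encodes a boundary as a degenerate square, so that boundaries can be rewritten by the calculus
of horizontal composition. -/
lemma osq_of_eq_one (p : Cell X Y) : OSq o p p (one f) (one g) ↔ Bd o p f g := by
  cases o with
  | lax =>
    constructor
    · rintro ⟨c, h, h'⟩
      exact ⟨h'.mid_eq.symm, h.mid_eq⟩
    · rintro ⟨rfl, rfl⟩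
      exact .of_eq_one p
  | colax =>
    constructor
    · rintro ⟨c, h, h'⟩
      exact ⟨h.mid_eq.symm, h'.mid_eq⟩
    · rintro ⟨rfl, rfl⟩
      exact (Sq.of_eq_one p).symm

lemma OComp.eq_of_is_s_left (h : OComp o a b c) (ha : a.Is .s) : b = c := by
  rw [is_s_iff.1 ha] at h
  cases o with
  | lax => exact h.eq_of_one_left
  | colax => exact h.eq_of_one_right

end Cell

/-! ### Lifting and testing oriented 2-cells into a limit. -/

namespace LooseCone.IsLimit

variable {J : Type u} [FCategory.{u} J] {K : Type v₁} [FCategory.{u} K]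
  {W : FFunctor J BbF.{u}} {D : FFunctor J K} {X Z : K} {γ : LooseCone W D X} (hγ : γ.IsLimit)
  {o : Orientation}
include hγ

/-- The colax case is the lax one with `f` and `g` exchanged. -/
lemma exists_lift_cell {f g : Z ⟶ X} (c : ∀ j, wObj W j → Cell Z (D.obj j))
    (bd : ∀ j y, Bd o (c j y) (f ≫ (γ.proj j).obj y) (g ≫ (γ.proj j).obj y))
    (nat : ∀ (j : J) {y z : wObj W j} (t : y ⟶ z),
      OSq o (c j y) (c j z) (one f ⋆ cell ((γ.proj j).map t)) (one g ⋆ cell ((γ.proj j).map t)))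
    (nat' : ∀ {i j : J} (f : i ⟶ j) (y : wObj W i),
      c j ((wMap W f).obj y) = c i y ⋆ one (D.map f)) :
    ∃ d : Cell Z X, Bd o d f g ∧ ∀ j y, d ⋆ one ((γ.proj j).obj y) = c j y := by
  cases o with
  | lax =>
    obtain ⟨α, hα⟩ := hγ.exists_lift₂ f g c (fun j y => (bd j y).1) (fun j y => (bd j y).2)
      (fun j _ _ t => Sq.symm (nat j t)) nat'
    exact ⟨cell α, ⟨rfl, rfl⟩, hα⟩
  | colax =>
    obtain ⟨α, hα⟩ := hγ.exists_lift₂ g f c (fun j y => (bd j y).1) (fun j y => (bd j y).2)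
      (fun j _ _ t => nat j t) nat'
    exact ⟨cell α, ⟨rfl, rfl⟩, hα⟩

lemma osq_ext {p q x y : Cell Z X} (hp : Bd o p x.src y.src) (hq : Bd o q x.tgt y.tgt)
    (h : ∀ (j : J) (k : wObj W j), OSq o (p ⋆ one ((γ.proj j).obj k))
      (q ⋆ one ((γ.proj j).obj k)) (x ⋆ one ((γ.proj j).obj k))
      (y ⋆ one ((γ.proj j).obj k))) : OSq o p q x y := by
  cases o with
  | lax => exact hγ.sq_ext hp.1 hq.2.symm hp.2 hq.1.symm h
  | colax => exact hγ.sq_ext hp.1.symm hq.2 hq.1.symm hp.2 h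

lemma ocomp_ext {a b c : Cell Z X} {f g k : Z ⟶ X} (ha : Bd o a f g) (hb : Bd o b g k)
    (hc : Bd o c f k)
    (h : ∀ (j : J) (y : wObj W j), OComp o (a ⋆ one ((γ.proj j).obj y))
      (b ⋆ one ((γ.proj j).obj y)) (c ⋆ one ((γ.proj j).obj y))) : OComp o a b c := by
  cases o with
  | lax =>
    exact hγ.vcomp_ext (hc.1.trans ha.1.symm) (hc.2.trans hb.2.symm) (ha.2.trans hb.1.symm) h
  | colax =>
    exact hγ.vcomp_ext (hc.1.trans hb.1.symm) (hc.2.trans ha.2.symm) (hb.2.trans ha.1.symm) h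

end LooseCone.IsLimit

/-! ## Transformations in terms of 2-cells with boundary -/

section Trans

variable {S : Type v₁} [FCategory.{u} S] {C : Type v₂} [FCategory.{u} C]

/-- The conditions on the 1-cells `app` and the 2-cells `nat` which make them a loose
`(s, w)`-natural transformation `M ⇒ N`, whose structure 2-cells have orientation `o`. -/
structure IsTrans (o : Orientation) (w : Weakness) (M N : FFunctor S C)
    (app : ∀ a, M.obj a ⟶ N.obj a)
    (nat : ∀ {a b : S}, (a ⟶ b) → Cell (M.obj a) (N.obj b)) : Prop where
  bd {a b : S} (f : a ⟶ b) : Bd o (nat f) (app a ≫ N.map f) (M.map f ≫ app b)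
  naturality {a b : S} {f g : a ⟶ b} (θ : f ⟶ g) :
    OSq o (nat f) (nat g) (one (app a) ⋆ cell (N.map₂ θ)) (cell (M.map₂ θ) ⋆ one (app b))
  id (a : S) : nat (𝟙 a) = one (app a)
  comp {a b c : S} (f : a ⟶ b) (g : b ⟶ c) :
    OComp o (nat f ⋆ one (N.map g)) (one (M.map f) ⋆ nat g) (nat (f ≫ g))
  is_w {a b : S} (f : a ⟶ b) : (nat f).Is w
  is_s {a b : S} (f : a ⟶ b) : FCategory.IsTight f → (nat f).Is .s

/-- A strict natural transformation. -/
lemma IsTrans.of_strict (o : Orientation) (w : Weakness) {M N : FFunctor S C}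
    {app : ∀ a, M.obj a ⟶ N.obj a}
    (h : ∀ {a b : S} {f g : a ⟶ b} (θ : f ⟶ g),
      one (app a) ⋆ cell (N.map₂ θ) = cell (M.map₂ θ) ⋆ one (app b)) :
    IsTrans o w M N app (fun {a _} f => one (app a ≫ N.map f)) where
  bd {a b} f := by
    have := h (𝟙 f)
    rw [N.map₂_id, M.map₂_id, cell_id, cell_id, ← one_comp, ← one_comp] at this
    rw [← one_injective this]
    exact bd_one _
  naturality {a b f g} θ := by
    rw [← h θ]
    obtain ⟨e⟩ : Nonempty (Sq (one (app a ≫ N.map f)) (one (app a) ⋆ cell (N.map₂ θ))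
        (one (app a) ⋆ cell (N.map₂ θ)) (one (app a ≫ N.map g))) :=
      ⟨(Sq.of_eq_one (one (app a) ⋆ cell (N.map₂ θ))).symm⟩
    cases o with
    | lax => exact e
    | colax => exact e.symm
  id a := by rw [N.map_id, Strict.comp_id]
  comp {a b c} f g := by
    have := h (𝟙 f)
    rw [N.map₂_id, M.map₂_id, cell_id, cell_id, ← one_comp, ← one_comp] at this
    rw [← one_comp, ← one_comp, ← Strict.assoc, ← one_injective this, N.map_comp, Strict.assoc]
    cases o <;> exact VComp.one_left (one _)
  is_w f := is_one _ _
  is_s f _ := is_one _ _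

end Trans

/-- A presentation of the `ℱ`-category `A` as the `ℱ`-category of a class of `ℱ`-functors
`S ⟶ C`, loose `(s, w)`-natural transformations, with structure 2-cells of orientation `o`,
and modifications. -/
structure TransTheory (o : Orientation) (w : Weakness) (S : Type v₁) [FCategory.{u} S]
    (C : Type v₂) [FCategory.{u} C] (A : Type v₃) [FCategory.{u} A] where
  F : A → FFunctor S C
  app {x y : A} (φ : x ⟶ y) (a : S) : (F x).obj a ⟶ (F y).obj a
  nat {x y : A} (φ : x ⟶ y) {a b : S} (f : a ⟶ b) : Cell ((F x).obj a) ((F y).obj b)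
  app₂ {x y : A} {φ ψ : x ⟶ y} (Γ : φ ⟶ ψ) (a : S) : app φ a ⟶ app ψ a
  app_id (x : A) (a : S) : app (𝟙 x) a = 𝟙 _
  app_comp {x y z : A} (φ : x ⟶ y) (ψ : y ⟶ z) (a : S) : app (φ ≫ ψ) a = app φ a ≫ app ψ a
  app₂_id {x y : A} (φ : x ⟶ y) (a : S) : app₂ (𝟙 φ) a = 𝟙 _
  app₂_comp {x y : A} {φ ψ χ : x ⟶ y} (Γ : φ ⟶ ψ) (Γ' : ψ ⟶ χ) (a : S) :
    app₂ (Γ ≫ Γ') a = app₂ Γ a ≫ app₂ Γ' a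
  app₂_whiskerLeft {x y z : A} (φ : x ⟶ y) {ψ χ : y ⟶ z} (Γ : ψ ⟶ χ) (a : S) :
    cell (app₂ (φ ◁ Γ) a) = one (app φ a) ⋆ cell (app₂ Γ a)
  app₂_whiskerRight {x y z : A} {φ ψ : x ⟶ y} (Γ : φ ⟶ ψ) (χ : y ⟶ z) (a : S) :
    cell (app₂ (Γ ▷ χ) a) = cell (app₂ Γ a) ⋆ one (app χ a)
  isTrans {x y : A} (φ : x ⟶ y) : IsTrans o w (F x) (F y) (app φ) (nat φ)
  hom_ext {x y : A} {φ ψ : x ⟶ y} (h : ∀ a, app φ a = app ψ a)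
    (h' : ∀ {a b : S} (f : a ⟶ b), nat φ f = nat ψ f) : φ = ψ
  exists_hom {x y : A} {p : ∀ a, (F x).obj a ⟶ (F y).obj a}
    {n : ∀ {a b : S}, (a ⟶ b) → Cell ((F x).obj a) ((F y).obj b)}
    (h : IsTrans o w (F x) (F y) p n) :
    ∃ φ : x ⟶ y, (∀ a, app φ a = p a) ∧ ∀ {a b : S} (f : a ⟶ b), nat φ f = n f
  isMod {x y : A} {φ ψ : x ⟶ y} (Γ : φ ⟶ ψ) {a b : S} (f : a ⟶ b) :
    OSq o (nat φ f) (nat ψ f) (cell (app₂ Γ a) ⋆ one ((F y).map f))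
      (one ((F x).map f) ⋆ cell (app₂ Γ b))
  hom₂_ext {x y : A} {φ ψ : x ⟶ y} {Γ Γ' : φ ⟶ ψ} (h : ∀ a, app₂ Γ a = app₂ Γ' a) : Γ = Γ'
  exists_hom₂ {x y : A} {φ ψ : x ⟶ y} (p : ∀ a, app φ a ⟶ app ψ a)
    (h : ∀ {a b : S} (f : a ⟶ b), OSq o (nat φ f) (nat ψ f) (cell (p a) ⋆ one ((F y).map f))
      (one ((F x).map f) ⋆ cell (p b))) : ∃ Γ : φ ⟶ ψ, ∀ a, app₂ Γ a = p a
  nat_comp {x y z : A} (φ : x ⟶ y) (ψ : y ⟶ z) {a b : S} (f : a ⟶ b) :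
    OComp o (one (app φ a) ⋆ nat ψ f) (nat φ f ⋆ one (app ψ b)) (nat (φ ≫ ψ) f)
  tight_iff {x y : A} (φ : x ⟶ y) : FCategory.IsTight φ ↔
    (∀ a, FCategory.IsTight (app φ a)) ∧ ∀ {a b : S} (f : a ⟶ b), (nat φ f).Is .s

/-! ### Strict transformations, and recognition of limit cones through evaluations. -/

namespace TransTheory

variable {o : Orientation} {w : Weakness} {S : Type v₁} [FCategory.{u} S]
  {C : Type v₂} [FCategory.{u} C] {A : Type v₃} [FCategory.{u} A] (T : TransTheory o w S C A)

/-- Evaluation. -/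
def ev (a : S) : FFunctor A C :=
  FFunctor.ofCell (fun x => (T.F x).obj a) (fun φ => T.app φ a) (fun Γ => T.app₂ Γ a)
    (fun φ => T.app₂_id φ a) (fun Γ Γ' => T.app₂_comp Γ Γ' a) (fun x => T.app_id x a)
    (fun φ ψ => T.app_comp φ ψ a) (fun φ _ _ Γ => T.app₂_whiskerLeft φ Γ a)
    (fun Γ χ => T.app₂_whiskerRight Γ χ a) (fun h => ((T.tight_iff _).1 h).1 a)

/-- The structure 2-cells are identities. -/
def IsStrict {x y : A} (φ : x ⟶ y) : Prop := ∀ ⦃a b : S⦄ (f : a ⟶ b), (T.nat φ f).Is .s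

variable {T} {x y z : A}

/-- The structure 2-cells are two opposite sides of the naturality square. When they are identities
the other two sides agree, whatever the orientation. -/
lemma IsStrict.naturality₂ {φ : x ⟶ y} (h : T.IsStrict φ) {a b : S} {f g : a ⟶ b} (θ : f ⟶ g) :
    one (T.app φ a) ⋆ cell ((T.F y).map₂ θ) = cell ((T.F x).map₂ θ) ⋆ one (T.app φ b) :=
  ((T.isTrans φ).naturality θ).eq_of_is_s (h f) (h g)

lemma IsStrict.naturality {φ : x ⟶ y} (h : T.IsStrict φ) {a b : S} (f : a ⟶ b) :
    one (T.app φ a) ⋆ one ((T.F y).map f) = one ((T.F x).map f) ⋆ one (T.app φ b) := by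
  rw [← one_comp, ← one_comp, ((T.isTrans φ).bd f).eq_of_is_s (h f)]

lemma IsStrict.modification {φ ψ : x ⟶ y} (hφ : T.IsStrict φ) (hψ : T.IsStrict ψ) (Γ : φ ⟶ ψ)
    {a b : S} (f : a ⟶ b) : cell (T.app₂ Γ a) ⋆ one ((T.F y).map f) =
      one ((T.F x).map f) ⋆ cell (T.app₂ Γ b) :=
  (T.isMod Γ f).eq_of_is_s (hφ f) (hψ f)

/-- One of the two factors of the composite structure 2-cell is an identity. Thus a strict
projection whiskers the structure 2-cells of `φ` and adds nothing of its own, which lets the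
projections of a limit see them. -/
lemma IsStrict.nat_comp {ψ : y ⟶ z} (hψ : T.IsStrict ψ) (φ : x ⟶ y) {a b : S} (f : a ⟶ b) :
    T.nat (φ ≫ ψ) f = T.nat φ f ⋆ one (T.app ψ b) :=
  ((T.nat_comp φ ψ f).eq_of_is_s_left ((hψ f).whiskerLeft _)).symm

lemma ext_cell {c d : Cell x y} (hs : c.src = d.src) (ht : c.tgt = d.tgt)
    (h : ∀ a, (T.ev a).mapCell c = (T.ev a).mapCell d) : c = d := by
  obtain ⟨α⟩ := c
  obtain ⟨β⟩ := d
  obtain rfl := hs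
  obtain rfl := ht
  exact congrArg cell (T.hom₂_ext fun a => cell_injective (h a))

/-- A cone of strict projections over a diagram of strict transformations is a limit cone as soon
as it is so pointwise. -/
theorem isLimit_of_ev {J : Type u} [FCategory.{u} J] {W : FFunctor J BbF.{u}}
    {D : FFunctor J A} {M : A} (γ : LooseCone W D M)
    (sD : ∀ {i j : J} (g : i ⟶ j), T.IsStrict (D.map g))
    (sγ : ∀ (j : J) (y : wObj W j), T.IsStrict ((γ.proj j).obj y))
    (hw : w = .s ∨ ∀ j, Function.Surjective (FullEmb.incl (W.obj j)).obj)
    (h : ∀ a, (γ.map (T.ev a)).IsLimit) : γ.IsLimit := by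
  refine LooseCone.isLimit_of ?_ ?_ ?_ ?_ ?_
  · intro N f g e
    have e₁ (a : S) : T.app f a = T.app g a := (h a).hom_ext fun j y z t => by
      have := congrArg (T.ev a).mapCell (e j t)
      rw [FFunctor.mapCell_hcomp, FFunctor.mapCell_hcomp, FFunctor.mapCell_one,
        FFunctor.mapCell_one] at this
      exact this
    refine T.hom_ext e₁ fun {a b} k => ?_
    have b₁ := (T.isTrans f).bd k
    have b₂ := (T.isTrans g).bd k
    rw [← e₁, ← e₁] at b₂
    -- Whiskered with a strict projection, the structure 2-cells of `f` and `g` become those of the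
    -- composites of `f` and `g` with it, which are equal.
    refine (h b).cell_ext (b₁.src_eq b₂) (b₁.tgt_eq b₂) fun j y => ?_
    have e₂ : f ≫ (γ.proj j).obj y = g ≫ (γ.proj j).obj y := congrArg Cell.src (e j (𝟙 y))
    have := (sγ j y).nat_comp f k
    rw [e₂, (sγ j y).nat_comp g k] at this
    exact this.symm
  · intro N δ
    choose φ hφ using fun a => show ∃ p : (T.F N).obj a ⟶ (T.F M).obj a,
      ∀ (j : J) {y z : wObj W j} (t : y ⟶ z), one p ⋆ cell (T.app₂ ((γ.proj j).map t) a) =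
        cell (T.app₂ ((δ.proj j).map t) a) from (h a).exists_lift (δ.map (T.ev a))
    have hφ₁ (a : S) (j : J) (y : wObj W j) :
        one (φ a) ⋆ one (T.app ((γ.proj j).obj y) a) = one (T.app ((δ.proj j).obj y) a) := by
      have := congrArg Cell.src (hφ a j (𝟙 y))
      rw [← one_comp]
      exact congrArg one this
    -- The structure 2-cells at `f` of the components of `δ` lift to a 2-cell into the limit at `b`.
    -- They are compatible with morphisms of `W(j)` because `δ` sends these to modifications, and
    -- with morphisms of `J` because the `D g` are strict.
    have key {a b : S} (f : a ⟶ b) : ∃ d : Cell ((T.F N).obj a) ((T.F M).obj b),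
        Bd o d (φ a ≫ (T.F M).map f) ((T.F N).map f ≫ φ b) ∧
        ∀ (j : J) (y : wObj W j), d ⋆ one (T.app ((γ.proj j).obj y) b) =
          T.nat ((δ.proj j).obj y) f := by
      refine (h b).exists_lift_cell (fun j y => T.nat ((δ.proj j).obj y) f) (fun j y => ?_)
        (fun j y z t => ?_) (fun {i j} g y => ?_)
      · have := (T.isTrans ((δ.proj j).obj y)).bd f
        rw [← osq_of_eq_one, one_comp, one_comp, ← hφ₁, ← hφ₁, hcomp_assoc,
          (sγ j y).naturality, ← hcomp_assoc, ← hcomp_assoc, ← one_comp, ← one_comp, ← one_comp,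
          ← one_comp, osq_of_eq_one] at this
        exact this
      · have := T.isMod ((δ.proj j).map t) f
        rw [← hφ, ← hφ, hcomp_assoc, (sγ j y).modification (sγ j z), ← hcomp_assoc,
          ← hcomp_assoc, ← one_comp, ← one_comp] at this
        exact this
      · rw [δ.naturality_obj, (sD g).nat_comp]
        rfl
    choose n bn hn using @key
    -- After composition with a strict projection, each axiom becomes the same axiom for a component
    -- of `δ`.
    have isT : IsTrans o w (T.F N) (T.F M) φ n := by
      refine ⟨bn, fun {a b f g} θ => ?_, fun a => ?_, fun {a b c} f g => ?_, fun {a b} f => ?_,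
        fun {a b} f hf => ?_⟩
      · refine (h b).osq_ext (bn f) (bn g) fun j y => ?_
        have := (T.isTrans ((δ.proj j).obj y)).naturality θ
        rw [← hn, ← hn, ← hφ₁, ← hφ₁, hcomp_assoc, (sγ j y).naturality₂, ← hcomp_assoc,
          ← hcomp_assoc] at this
        exact this
      · have b₁ := bn (𝟙 a)
        rw [FFunctor.map_id, FFunctor.map_id, Strict.id_comp, Strict.comp_id] at b₁
        refine (h a).cell_ext (b₁.src_eq (bd_one _)) (b₁.tgt_eq (bd_one _)) fun j y => ?_
        have := (T.isTrans ((δ.proj j).obj y)).id a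
        rw [← hn, ← hφ₁] at this
        exact this
      · have b₁ := (bn f).whiskerRight ((T.F M).map g)
        have b₂ := (bn g).whiskerLeft ((T.F N).map f)
        have b₃ := bn (f ≫ g)
        rw [FFunctor.map_comp, FFunctor.map_comp, ← Strict.assoc] at b₃
        rw [Strict.assoc ((T.F N).map f)] at b₁
        rw [← Strict.assoc ((T.F N).map f) ((T.F N).map g)] at b₂
        refine (h c).ocomp_ext b₁ b₂ b₃ fun j y => ?_
        have := (T.isTrans ((δ.proj j).obj y)).comp f g
        rw [← hn, ← hn, ← hn, hcomp_assoc, (sγ j y).naturality, ← hcomp_assoc,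
          ← hcomp_assoc] at this
        exact this
      · refine (h b).is_ext fun j y => ?_
        have := (T.isTrans ((δ.proj j).obj y)).is_w f
        rwa [← hn] at this
      · refine (h b).is_ext fun j y => ?_
        have := (T.isTrans ((δ.proj j).obj y)).is_s f hf
        rwa [← hn] at this
    obtain ⟨ψ, hψ, hψ'⟩ := T.exists_hom isT
    have e (j : J) (y : wObj W j) : ψ ≫ (γ.proj j).obj y = (δ.proj j).obj y := by
      refine T.hom_ext (fun a => ?_) (fun {a b} f => ?_)
      · rw [T.app_comp, hψ]
        exact one_injective ((one_comp _ _).trans (hφ₁ a j y))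
      · rw [(sγ j y).nat_comp, hψ', hn]
    refine ⟨ψ, fun j y z t => ext_cell (T := T) (e j y) (e j z) fun a => ?_⟩
    rw [FFunctor.mapCell_hcomp, FFunctor.mapCell_one]
    refine Eq.trans ?_ (hφ a j t)
    rw [← hψ]
    rfl
  · intro N f g α β e
    refine T.hom₂_ext fun a => (h a).hom₂_ext fun j y => ?_
    have := congrArg (T.ev a).mapCell (e j y)
    rw [FFunctor.mapCell_hcomp, FFunctor.mapCell_hcomp, FFunctor.mapCell_one] at this
    exact this
  · intro N f g c nat nat'
    choose α hα using fun a => (h a).exists_lift₂ (T.app f a) (T.app g a)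
      (fun j y => cell (T.app₂ (c j y) a)) (fun j y => T.app_comp _ _ a)
      (fun j y => T.app_comp _ _ a)
      (fun j y z t => by
        obtain ⟨d, hd, hd'⟩ := nat j t
        refine ⟨(T.ev a).mapCell d, ?_, ?_⟩
        · have := (T.ev a).mapCell_vcomp hd
          rw [FFunctor.mapCell_hcomp, FFunctor.mapCell_one] at this
          exact this
        · have := (T.ev a).mapCell_vcomp hd'
          rw [FFunctor.mapCell_hcomp, FFunctor.mapCell_one] at this
          exact this)
      (fun k y => by
        have := congrArg (T.ev a).mapCell (nat' k y)
        rw [FFunctor.mapCell_hcomp, FFunctor.mapCell_one] at this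
        exact this)
    replace hα (a : S) (j : J) (y : wObj W j) :
      cell (α a) ⋆ one (T.app ((γ.proj j).obj y) a) = cell (T.app₂ (c j y) a) := hα a j y
    obtain ⟨Γ, hΓ⟩ := T.exists_hom₂ α fun {a b} k => by
      refine (h b).osq_ext ((T.isTrans f).bd k) ((T.isTrans g).bd k) fun j y => ?_
      have := T.isMod (c j y) k
      rw [(sγ j y).nat_comp, (sγ j y).nat_comp, ← hα, ← hα, hcomp_assoc, (sγ j y).naturality,
        ← hcomp_assoc, ← hcomp_assoc] at this
      exact this
    refine ⟨Γ, fun j y => ext_cell (T := T) rfl rfl fun a => ?_⟩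
    rw [FFunctor.mapCell_hcomp, FFunctor.mapCell_one]
    refine Eq.trans ?_ (hα a j y)
    rw [← hΓ]
    rfl
  · intro N f
    rw [T.tight_iff]
    constructor
    · rintro ⟨h₁, h₂⟩ j y
      rw [T.tight_iff]
      refine ⟨fun a => ?_, fun {a b} k => ?_⟩
      · rw [T.app_comp]
        exact ((h a).isTight_iff _).1 (h₁ a) j y
      · rw [(sγ j _).nat_comp]
        exact (h₂ k).whiskerRight _
    · intro H
      refine ⟨fun a => ((h a).isTight_iff _).2 fun j y => ?_, fun {a b} k => ?_⟩
      · have := ((T.tight_iff _).1 (H j y)).1 a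
        rw [T.app_comp] at this
        exact this
      -- The hypothesis makes the structure 2-cells identities only after the projections at the
      -- tight part of `W(j)`, whereas `is_ext` needs all projections. Surjectivity bridges the gap,
      -- unless `w = s` makes the claim automatic.
      · obtain rfl | hs := hw
        · exact (T.isTrans f).is_w k
        · refine (h b).is_ext fun j y => ?_
          obtain ⟨y, rfl⟩ := hs j y
          have := ((T.tight_iff _).1 (H j y)).2 k
          rw [(sγ j _).nat_comp] at this
          exact this

end TransTheory

section HcompFunctor

variable {K : Type v} [FCategory.{u} K] {X Y Z : K} {A : Type v₁} [Category.{v₂} A]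
  {A' : Type v₃} [Category.{v₄} A']

/-- The horizontal composite of two functors to hom-categories. -/
@[simps]
def hcompFunctor (F : A ⥤ (X ⟶ Y)) (G : A' ⥤ (Y ⟶ Z)) : A ⥤ A' ⥤ (X ⟶ Z) where
  obj x :=
    { obj y := F.obj x ≫ G.obj y
      map t := F.obj x ◁ G.map t }
  map s :=
    { app y := F.map s ▷ G.obj y
      naturality _ _ t := whisker_exchange (F.map s) (G.map t) }

end HcompFunctor

/-! ## Pointwise limits -/

section Pointwise

variable {o : Orientation} {w : Weakness} {S : Type v₁} [FCategory.{u} S]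
  {C : Type v₂} [FCategory.{u} C] {A : Type v₃} [FCategory.{u} A] {T : TransTheory o w S C A}
  {J : Type u} [FCategory.{u} J] {W : FFunctor J BbF.{u}} {D : FFunctor J A}

/-- Cones over the diagrams `D(-)(a)`, natural in `a`. -/
structure PointwiseCone (T : TransTheory o w S C A) (W : FFunctor J BbF.{u}) (D : FFunctor J A)
    (M : FFunctor S C) where
  proj (a : S) (j : J) : wObj W j ⥤ (M.obj a ⟶ (T.F (D.obj j)).obj a)
  cell_naturality (a : S) {i j : J} (f : i ⟶ j) {y z : wObj W i} (t : y ⟶ z) :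
    cell ((proj a j).map ((wMap W f).map t)) =
      cell ((proj a i).map t) ⋆ one (T.app (D.map f) a)
  cell_naturality₂ (a : S) {i j : J} {f g : i ⟶ j} (α : f ⟶ g) (y : wObj W i) :
    cell ((proj a j).map ((wMap₂ W α).app y)) =
      one ((proj a i).obj y) ⋆ cell (T.app₂ (D.map₂ α) a)
  map {a b : S} (f : a ⟶ b) (j : J) {y z : wObj W j} (t : y ⟶ z) :
    one (M.map f) ⋆ cell ((proj b j).map t) =
      cell ((proj a j).map t) ⋆ one ((T.F (D.obj j)).map f)
  map₂ {a b : S} {f g : a ⟶ b} (θ : f ⟶ g) (j : J) (y : wObj W j) :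
    cell (M.map₂ θ) ⋆ one ((proj b j).obj y) =
      one ((proj a j).obj y) ⋆ cell ((T.F (D.obj j)).map₂ θ)

namespace PointwiseCone

variable {M : FFunctor S C} (q : PointwiseCone T W D M)

lemma one_map {a b : S} (f : a ⟶ b) (j : J) (y : wObj W j) :
    one (M.map f) ⋆ one ((q.proj b j).obj y) =
      one ((q.proj a j).obj y) ⋆ one ((T.F (D.obj j)).map f) := by
  have := q.map₂ (𝟙 f) j y
  rwa [PrelaxFunctor.map₂_id, PrelaxFunctor.map₂_id, cell_id, cell_id] at this

lemma one_naturality (a : S) {i j : J} (f : i ⟶ j) (y : wObj W i) :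
    one ((q.proj a j).obj ((wMap W f).obj y)) =
      one ((q.proj a i).obj y) ⋆ one (T.app (D.map f) a) := by
  have := q.cell_naturality a f (𝟙 y)
  rwa [CategoryTheory.Functor.map_id, CategoryTheory.Functor.map_id,
    CategoryTheory.Functor.map_id, cell_id, cell_id] at this

/-- The cone over `D(-)(a)`. -/
def cone (a : S) : LooseCone W (D.comp (T.ev a)) (M.obj a) :=
  LooseCone.ofCell (q.proj a) (fun f _ _ t => q.cell_naturality a f t)
    (fun α y => q.cell_naturality₂ a α y)

end PointwiseCone

/-- Limits of the diagrams `D(-)(a)` underlie an `ℱ`-functor of `a`. -/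
theorem exists_pointwiseCone (sD : ∀ {i j : J} (g : i ⟶ j), T.IsStrict (D.map g))
    (X : S → C) (γ : ∀ a, LooseCone W (D.comp (T.ev a)) (X a)) (tγ : ∀ a, (γ a).IsTight)
    (hγ : ∀ a, (γ a).IsLimit) :
    ∃ (M : FFunctor S C) (q : PointwiseCone T W D M),
      ∀ a, (q.cone a).IsTight ∧ (q.cone a).IsLimit := by
  -- Restates the projections with codomain `(T.F (D.obj j)).obj a`, the form in which the
  -- strictness lemmas for `D` apply.
  obtain ⟨q, hq⟩ : ∃ q : ∀ a (j : J), wObj W j ⥤ (X a ⟶ (T.F (D.obj j)).obj a),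
    q = fun a j => (γ a).proj j := ⟨_, rfl⟩
  have qn (a : S) {i j : J} (f : i ⟶ j) {y z : wObj W i} (t : y ⟶ z) :
      cell ((q a j).map ((wMap W f).map t)) =
        cell ((q a i).map t) ⋆ one (T.app (D.map f) a) := by
    subst hq
    exact (γ a).cell_naturality f t
  have qn₁ (a : S) {i j : J} (f : i ⟶ j) (y : wObj W i) :
      one ((q a j).obj ((wMap W f).obj y)) =
        one ((q a i).obj y) ⋆ one (T.app (D.map f) a) := by
    subst hq
    exact (γ a).one_naturality f y
  have qn₂ (a : S) {i j : J} {f g : i ⟶ j} (α : f ⟶ g) (y : wObj W i) :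
      cell ((q a j).map ((wMap₂ W α).app y)) =
        one ((q a i).obj y) ⋆ cell (T.app₂ (D.map₂ α) a) := by
    subst hq
    exact (γ a).cell_naturality₂ α y
  -- The limit projections at `a`, followed by the actions of the `T.F (D.obj j)`, form a family of
  -- cones over `D(-)(b)` functorial in `f : a ⟶ b`. Strictness of the `D g` is what gives
  -- compatibility over `J`.
  have key (a b : S) : ∃ M : (a ⟶ b) ⥤ (X a ⟶ X b),
      (∀ (j : J) {y z : wObj W j} (t : y ⟶ z) (f : a ⟶ b),
        one (M.obj f) ⋆ cell ((q b j).map t) =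
          cell ((q a j).map t) ⋆ one ((T.F (D.obj j)).map f)) ∧
      ∀ (j : J) (y : wObj W j) {f g : a ⟶ b} (θ : f ⟶ g),
        cell (M.map θ) ⋆ one ((q b j).obj y) =
          one ((q a j).obj y) ⋆ cell ((T.F (D.obj j)).map₂ θ) := by
    have n₁ {i j : J} (g : i ⟶ j) {y z : wObj W i} (t : y ⟶ z) (f : a ⟶ b) :
        cell ((q a j).map ((wMap W g).map t)) ⋆ one ((T.F (D.obj j)).map f) =
          (cell ((q a i).map t) ⋆ one ((T.F (D.obj i)).map f)) ⋆ one (T.app (D.map g) b) := by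
      rw [qn, hcomp_assoc, (sD g).naturality, ← hcomp_assoc]
    have n₂ {i j : J} (g : i ⟶ j) (y : wObj W i) {f f' : a ⟶ b} (θ : f ⟶ f') :
        one ((q a j).obj ((wMap W g).obj y)) ⋆ cell ((T.F (D.obj j)).map₂ θ) =
          (one ((q a i).obj y) ⋆ cell ((T.F (D.obj i)).map₂ θ)) ⋆ one (T.app (D.map g) b) := by
      rw [qn₁, hcomp_assoc, (sD g).naturality₂, ← hcomp_assoc]
    have n₃ {i j : J} {g g' : i ⟶ j} (α : g ⟶ g') (y : wObj W i) (f : a ⟶ b) :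
        cell ((q a j).map ((wMap₂ W α).app y)) ⋆ one ((T.F (D.obj j)).map f) =
          one ((q a i).obj y ≫ (T.F (D.obj i)).map f) ⋆ cell (T.app₂ (D.map₂ α) b) := by
      rw [qn₂, one_comp, hcomp_assoc, (sD g).modification (sD g'), ← hcomp_assoc]
    obtain ⟨M, hM, hM'⟩ := (hγ b).exists_lift_functor (Z := X a) (A := a ⟶ b)
      (fun j => hcompFunctor (q a j) ((T.F (D.obj j)).mapFunctor a b))
      (fun {i j} g {y z} t f => by
        exact (cell_whiskerRight _ _).trans
          ((n₁ g t f).trans (congrArg (· ⋆ one _) (cell_whiskerRight _ _).symm)))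
      (fun {i j} g y f f' θ => by
        exact (cell_whiskerLeft _ _).trans
          ((n₂ g y θ).trans (congrArg (· ⋆ one _) (cell_whiskerLeft _ _).symm)))
      (fun {i j g g'} α y f => by
        have := n₃ α y f
        rw [← cell_whiskerRight] at this
        exact this)
    refine ⟨M, fun j y z t f => ?_, fun j y f g θ => ?_⟩
    · rw [← cell_whiskerRight]
      subst hq
      exact hM j t f
    · rw [← cell_whiskerLeft]
      subst hq
      exact hM' j y θ
  choose M hM hM₂ using key
  have hM₁ {a b : S} (f : a ⟶ b) (j : J) (y : wObj W j) :
      one ((M a b).obj f) ⋆ one ((q b j).obj y) =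
        one ((q a j).obj y) ⋆ one ((T.F (D.obj j)).map f) := by
    have := hM₂ a b j y (𝟙 f)
    rwa [CategoryTheory.Functor.map_id, PrelaxFunctor.map₂_id, cell_id, cell_id] at this
  have e {a : S} {Z : C} {f g : Z ⟶ X a} (h : ∀ (j : J) {y z : wObj W j} (t : y ⟶ z),
      one f ⋆ cell ((q a j).map t) = one g ⋆ cell ((q a j).map t)) : f = g := by
    subst hq
    exact (hγ a).hom_ext h
  have e₂ {a : S} {Z : C} {c d : Cell Z (X a)} (hs : c.src = d.src) (ht : c.tgt = d.tgt)
      (h : ∀ (j : J) (y : wObj W j), c ⋆ one ((q a j).obj y) = d ⋆ one ((q a j).obj y)) :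
      c = d := by
    subst hq
    exact (hγ a).cell_ext hs ht h
  -- Preservation of identities and composites, and below of whiskerings, comes from uniqueness of
  -- lifts.
  have m_id (a : S) : (M a a).obj (𝟙 a) = 𝟙 (X a) := e fun j y z t => by
    rw [hM, FFunctor.map_id, hcomp_one_id, one_id_hcomp]
  have m_comp {a b c : S} (f : a ⟶ b) (g : b ⟶ c) :
      (M a c).obj (f ≫ g) = (M a b).obj f ≫ (M b c).obj g := e fun j y z t => by
    rw [hM, one_comp, hcomp_assoc, hM, ← hcomp_assoc, hM, hcomp_assoc, FFunctor.map_comp,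
      one_comp]
  refine ⟨FFunctor.ofCell X (fun {a b} f => (M a b).obj f) (fun {a b} f g θ => (M a b).map θ)
    (fun {a b} f => (M a b).map_id f) (fun {a b} f g h α β => (M a b).map_comp α β) m_id m_comp
    (fun {a b c} f {g h} α => ?_) (fun {a b c f g} α h => ?_) (fun {a b f} hf => ?_),
    { proj := q, cell_naturality := qn, cell_naturality₂ := qn₂,
      map := fun {a b} f j y z t => hM a b j t f,
      map₂ := fun {a b f g} θ j y => hM₂ a b j y θ }, fun a => ?_⟩
  · refine e₂ (m_comp _ _) (m_comp _ _) fun j y => ?_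
    rw [hM₂, ← FFunctor.mapCell_cell, cell_whiskerLeft, FFunctor.mapCell_hcomp,
      FFunctor.mapCell_one, ← hcomp_assoc, ← hM₁, hcomp_assoc, hcomp_assoc, hM₂]
    rfl
  · refine e₂ (m_comp _ _) (m_comp _ _) fun j y => ?_
    rw [hM₂, ← FFunctor.mapCell_cell, cell_whiskerRight, FFunctor.mapCell_hcomp,
      FFunctor.mapCell_one, ← hcomp_assoc, FFunctor.mapCell_cell, ← hM₂, hcomp_assoc,
      hcomp_assoc, hM₁]
  -- The composite of the image of `f` with a projection at a tight element is a tight projection at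
  -- `a` followed by the image of the tight `f`. Such composites detect tightness at `b`.
  · refine ((hγ b).isTight_iff _).2 fun j y => ?_
    have h₁ := one_injective ((one_comp _ _).trans ((hM₁ f j
      ((FullEmb.incl (W.obj j)).obj y)).trans (one_comp _ _).symm))
    have h₂ := FCategory.tight_comp (tγ a j y) ((T.F (D.obj j)).map_tight hf)
    subst hq
    exact h₁ ▸ h₂
  · subst hq
    exact ⟨tγ a, hγ a⟩

/-- Limits commute with limits: a pointwise limit of `ℱ`-functors preserving the limit cone `κ`
preserves it. -/
theorem PointwiseCone.isLimit_map {M : FFunctor S C} (q : PointwiseCone T W D M)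
    (sD : ∀ {i j : J} (g : i ⟶ j), T.IsStrict (D.map g)) (tq : ∀ a, (q.cone a).IsTight)
    (hq : ∀ a, (q.cone a).IsLimit)
    {I : Type u} [FCategory.{u} I] {V : FFunctor I BbF.{u}} {E : FFunctor I S} {p : S}
    (κ : LooseCone V E p) (tκ : κ.IsTight) (hκ : ∀ j, (κ.map (T.F (D.obj j))).IsLimit) :
    (κ.map M).IsLimit := by
  -- Two families of tests are used: the projections of `q` for 1-cells and 2-cells into `M`, and
  -- the images of `κ` for those into the values at `p` of the diagram `D`.
  have e {a : S} {Z : C} {f g : Z ⟶ M.obj a} (h : ∀ (j : J) {y z : wObj W j} (t : y ⟶ z),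
      one f ⋆ cell ((q.proj a j).map t) = one g ⋆ cell ((q.proj a j).map t)) : f = g :=
    (hq a).hom_ext h
  have e₂ {a : S} {Z : C} {c d : Cell Z (M.obj a)} (hs : c.src = d.src) (ht : c.tgt = d.tgt)
      (h : ∀ (j : J) (y : wObj W j),
        c ⋆ one ((q.proj a j).obj y) = d ⋆ one ((q.proj a j).obj y)) : c = d :=
    (hq a).cell_ext hs ht h
  have e' {j : J} {Z : C} {f g : Z ⟶ (T.F (D.obj j)).obj p}
      (h : ∀ (i : I) {x x' : wObj V i} (s : x ⟶ x'),
        one f ⋆ cell ((T.F (D.obj j)).map₂ ((κ.proj i).map s)) =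
          one g ⋆ cell ((T.F (D.obj j)).map₂ ((κ.proj i).map s))) : f = g :=
    (hκ j).hom_ext h
  have e₂' {j : J} {Z : C} {c d : Cell Z ((T.F (D.obj j)).obj p)} (hs : c.src = d.src)
      (ht : c.tgt = d.tgt) (h : ∀ (i : I) (x : wObj V i),
        c ⋆ one ((T.F (D.obj j)).map ((κ.proj i).obj x)) =
          d ⋆ one ((T.F (D.obj j)).map ((κ.proj i).obj x))) : c = d :=
    (hκ j).cell_ext hs ht h
  have map_cell {i : I} {x x' : wObj V i} (s : x ⟶ x') (j : J) (y : wObj W j) :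
      cell (M.map₂ ((κ.proj i).map s)) ⋆ one ((q.proj (E.obj i) j).obj y) =
        one ((q.proj p j).obj y) ⋆ cell ((T.F (D.obj j)).map₂ ((κ.proj i).map s)) :=
    q.map₂ _ j y
  refine LooseCone.isLimit_of ?_ ?_ ?_ ?_ ?_
  · intro Z f g h
    replace h (i : I) {x x' : wObj V i} (s : x ⟶ x') :
      one f ⋆ cell (M.map₂ ((κ.proj i).map s)) = one g ⋆ cell (M.map₂ ((κ.proj i).map s)) := h i s
    have h₁ (i : I) (x : wObj V i) : one f ⋆ one (M.map ((κ.proj i).obj x)) =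
        one g ⋆ one (M.map ((κ.proj i).obj x)) := by
      have := h i (𝟙 x)
      rwa [CategoryTheory.Functor.map_id, M.map₂_id, cell_id] at this
    have h₂ (j : J) (y : wObj W j) : f ≫ (q.proj p j).obj y = g ≫ (q.proj p j).obj y :=
      e' fun i x x' s => by
        rw [one_comp, one_comp, hcomp_assoc, hcomp_assoc, ← map_cell, ← hcomp_assoc, h,
          hcomp_assoc]
    refine e fun j y z t => e₂' (h₂ j y) (h₂ j z) fun i x => ?_
    rw [hcomp_assoc, hcomp_assoc, ← q.map, ← hcomp_assoc, h₁, hcomp_assoc]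
  · intro Z δ
    obtain ⟨δp, hδ⟩ : ∃ δp : ∀ i, wObj V i ⥤ (Z ⟶ M.obj (E.obj i)), δp = δ.proj := ⟨_, rfl⟩
    have dn {i i' : I} (k : i ⟶ i') {x x' : wObj V i} (s : x ⟶ x') :
        cell ((δp i').map ((wMap V k).map s)) =
          cell ((δp i).map s) ⋆ one (M.map (E.map k)) := by
      subst hδ
      exact δ.cell_naturality k s
    have dn₁ {i i' : I} (k : i ⟶ i') (x : wObj V i) :
        one ((δp i').obj ((wMap V k).obj x)) = one ((δp i).obj x) ⋆ one (M.map (E.map k)) := by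
      subst hδ
      exact δ.one_naturality k x
    have dn₂ {i i' : I} {k k' : i ⟶ i'} (α : k ⟶ k') (x : wObj V i) :
        cell ((δp i').map ((wMap₂ V α).app x)) =
          one ((δp i).obj x) ⋆ cell (M.map₂ (E.map₂ α)) := by
      subst hδ
      exact δ.cell_naturality₂ α x
    -- For fixed `j`, composing `δ` with the projections of `q` gives cones over the image of `E`
    -- under `T.F (D.obj j)`, functorially in `y`. They lift along the preserved cone `κ`.
    have key (j : J) : ∃ G : wObj W j ⥤ (Z ⟶ (T.F (D.obj j)).obj p),
        (∀ (i : I) {x x' : wObj V i} (s : x ⟶ x') (y : wObj W j),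
          one (G.obj y) ⋆ cell ((T.F (D.obj j)).map₂ ((κ.proj i).map s)) =
            cell ((δp i).map s) ⋆ one ((q.proj (E.obj i) j).obj y)) ∧
        ∀ (i : I) (x : wObj V i) {y z : wObj W j} (t : y ⟶ z),
          cell (G.map t) ⋆ one ((T.F (D.obj j)).map ((κ.proj i).obj x)) =
            one ((δp i).obj x) ⋆ cell ((q.proj (E.obj i) j).map t) := by
      have n₁ {i i' : I} (k : i ⟶ i') {x x' : wObj V i} (s : x ⟶ x') (y : wObj W j) :
          cell ((δp i').map ((wMap V k).map s)) ⋆ one ((q.proj (E.obj i') j).obj y) =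
            (cell ((δp i).map s) ⋆ one ((q.proj (E.obj i) j).obj y)) ⋆
              one ((T.F (D.obj j)).map (E.map k)) := by
        rw [dn, hcomp_assoc, q.one_map, ← hcomp_assoc]
      have n₂ {i i' : I} (k : i ⟶ i') (x : wObj V i) {y z : wObj W j} (t : y ⟶ z) :
          one ((δp i').obj ((wMap V k).obj x)) ⋆ cell ((q.proj (E.obj i') j).map t) =
            (one ((δp i).obj x) ⋆ cell ((q.proj (E.obj i) j).map t)) ⋆
              one ((T.F (D.obj j)).map (E.map k)) := by
        rw [dn₁, hcomp_assoc, q.map, ← hcomp_assoc]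
      have n₃ {i i' : I} {k k' : i ⟶ i'} (α : k ⟶ k') (x : wObj V i) (y : wObj W j) :
          cell ((δp i').map ((wMap₂ V α).app x)) ⋆ one ((q.proj (E.obj i') j).obj y) =
            one ((δp i).obj x ≫ (q.proj (E.obj i) j).obj y) ⋆
              cell ((T.F (D.obj j)).map₂ (E.map₂ α)) := by
        rw [dn₂, one_comp, hcomp_assoc, q.map₂, ← hcomp_assoc]
      obtain ⟨G, hG, hG'⟩ := (hκ j).exists_lift_functor (Z := Z) (A := wObj W j)
        (fun i => hcompFunctor (δp i) (q.proj (E.obj i) j))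
        (fun {i i'} k {x x'} s y => by
          exact (cell_whiskerRight _ _).trans
            ((n₁ k s y).trans (congrArg (· ⋆ one _) (cell_whiskerRight _ _).symm)))
        (fun {i i'} k x y z t => by
          exact (cell_whiskerLeft _ _).trans
            ((n₂ k x t).trans (congrArg (· ⋆ one _) (cell_whiskerLeft _ _).symm)))
        (fun {i i' k k'} α x y => by
          have := n₃ α x y
          rw [← cell_whiskerRight] at this
          exact this)
      exact ⟨G, fun i x x' s y => (hG i s y).trans (cell_whiskerRight _ _),
        fun i x y z t => (hG' i x t).trans (cell_whiskerLeft _ _)⟩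
    choose G hG hG₂ using key
    have hG₁ (j : J) (i : I) (x : wObj V i) (y : wObj W j) :
        one ((G j).obj y) ⋆ one ((T.F (D.obj j)).map ((κ.proj i).obj x)) =
          one ((δp i).obj x) ⋆ one ((q.proj (E.obj i) j).obj y) := by
      have := hG₂ j i x (𝟙 y)
      rwa [CategoryTheory.Functor.map_id, CategoryTheory.Functor.map_id, cell_id, cell_id] at this
    have gn₁ {j j' : J} (g : j ⟶ j') (y : wObj W j) :
        (G j').obj ((wMap W g).obj y) = (G j).obj y ≫ T.app (D.map g) p := e' fun i x x' s => by
      rw [hG, q.one_naturality, one_comp, hcomp_assoc, (sD g).naturality₂, ← hcomp_assoc,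
        ← hcomp_assoc, hG]
    -- As `j` varies, the `G j` form a cone over `D(-)(p)`, by uniqueness of lifts along `κ`. Its
    -- lift is the required 1-cell.
    obtain ⟨f, hf⟩ : ∃ f : Z ⟶ M.obj p, ∀ (j : J) {y z : wObj W j} (t : y ⟶ z),
        one f ⋆ cell ((q.proj p j).map t) = cell ((G j).map t) :=
      (hq p).exists_lift (LooseCone.ofCell (D := D.comp (T.ev p)) G
        (fun {j j'} g {y z} t => by
          refine e₂' (gn₁ g y) (gn₁ g z) fun i x => ?_
          have : one (T.app (D.map g) p) ⋆ one ((T.F (D.obj j')).map ((κ.proj i).obj x)) =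
            one ((T.F (D.obj j)).map ((κ.proj i).obj x)) ⋆ one (T.app (D.map g) (E.obj i)) :=
            (sD g).naturality _
          change cell ((G j').map _) ⋆ one ((T.F (D.obj j')).map _) =
            (cell ((G j).map t) ⋆ one (T.app (D.map g) p)) ⋆ one ((T.F (D.obj j')).map _)
          rw [hG₂, q.cell_naturality, hcomp_assoc, this, ← hcomp_assoc, ← hcomp_assoc, hG₂])
        (fun {j j' g g'} α y => by
          refine e₂' (gn₁ g y) (gn₁ g' y) fun i x => ?_
          have : cell (T.app₂ (D.map₂ α) p) ⋆ one ((T.F (D.obj j')).map ((κ.proj i).obj x)) =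
            one ((T.F (D.obj j)).map ((κ.proj i).obj x)) ⋆
              cell (T.app₂ (D.map₂ α) (E.obj i)) :=
            (sD g).modification (sD g') _ _
          change cell ((G j').map _) ⋆ one ((T.F (D.obj j')).map _) =
            (one ((G j).obj y) ⋆ cell (T.app₂ (D.map₂ α) p)) ⋆ one ((T.F (D.obj j')).map _)
          rw [hG₂, q.cell_naturality₂, hcomp_assoc, this, ← hcomp_assoc, ← hcomp_assoc, hG₁]))
    have hf₁ (j : J) (y : wObj W j) : one f ⋆ one ((q.proj p j).obj y) = one ((G j).obj y) := by
      have := hf j (𝟙 y)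
      rwa [CategoryTheory.Functor.map_id, CategoryTheory.Functor.map_id, cell_id, cell_id] at this
    have fδ (i : I) (x : wObj V i) : f ≫ M.map ((κ.proj i).obj x) = (δp i).obj x :=
      e fun j y z t => by
        rw [one_comp, hcomp_assoc, q.map, ← hcomp_assoc, hf, hG₂]
    have fδ₂ (i : I) {x x' : wObj V i} (s : x ⟶ x') :
        one f ⋆ cell (M.map₂ ((κ.proj i).map s)) = cell ((δp i).map s) := by
      refine e₂ (fδ i x) (fδ i x') fun j y => ?_
      rw [hcomp_assoc, map_cell, ← hcomp_assoc, hf₁, hG]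
    subst hδ
    exact ⟨f, fδ₂⟩
  · intro Z f g α β h
    replace h (i : I) (x : wObj V i) : cell α ⋆ one (M.map ((κ.proj i).obj x)) =
      cell β ⋆ one (M.map ((κ.proj i).obj x)) := h i x
    refine cell_injective (e₂ rfl rfl fun j y => e₂' rfl rfl fun i x => ?_)
    rw [hcomp_assoc, hcomp_assoc, ← q.one_map, ← hcomp_assoc, h, hcomp_assoc]
  · intro Z f g c nat nat'
    replace nat' {i i' : I} (k : i ⟶ i') (x : wObj V i) :
      cell (c i' ((wMap V k).obj x)) = cell (c i x) ⋆ one (M.map (E.map k)) := nat' k x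
    have eq (f : Z ⟶ M.obj p) (j : J) (y : wObj W j) (i : I) (x : wObj V i) :
        (f ≫ M.map ((κ.proj i).obj x)) ≫ (q.proj (E.obj i) j).obj y =
          (f ≫ (q.proj p j).obj y) ≫ (T.F (D.obj j)).map ((κ.proj i).obj x) := by
      apply one_injective
      rw [one_comp, one_comp, one_comp, one_comp, hcomp_assoc, hcomp_assoc, q.one_map]
    -- The same double lifting for 2-cells: along the image of `κ` for each `j` and `y`, then along
    -- `q` at `p`.
    choose μ hμ using fun (j : J) (y : wObj W j) =>
      show ∃ μ : f ≫ (q.proj p j).obj y ⟶ g ≫ (q.proj p j).obj y, ∀ i x,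
        cell μ ⋆ one ((T.F (D.obj j)).map ((κ.proj i).obj x)) =
          (cell (c i x) ⋆ one ((q.proj (E.obj i) j).obj y) :
            Cell Z ((T.F (D.obj j)).obj (E.obj i))) from
      (hκ j).exists_lift₂ (f ≫ (q.proj p j).obj y) (g ≫ (q.proj p j).obj y)
        (fun i x => cell (c i x) ⋆ one ((q.proj (E.obj i) j).obj y)) (eq f j y) (eq g j y)
        (fun i x x' s => by
          have := (nat i s).whiskerRight ((q.proj (E.obj i) j).obj y)
          rw [hcomp_assoc, hcomp_assoc] at this
          have e₃ := map_cell s j y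
          rw [one_comp, one_comp, hcomp_assoc, hcomp_assoc]
          change Sq (one f ⋆ (one ((q.proj p j).obj y) ⋆
            cell ((T.F (D.obj j)).map₂ ((κ.proj i).map s)))) _ _ (one g ⋆
              (one ((q.proj p j).obj y) ⋆ cell ((T.F (D.obj j)).map₂ ((κ.proj i).map s))))
          rw [← e₃]
          exact this)
        (fun {i i'} k x => by
          rw [nat', hcomp_assoc, q.one_map, ← hcomp_assoc])
    obtain ⟨α, hα⟩ : ∃ α : f ⟶ g, ∀ j y, cell α ⋆ one ((q.proj p j).obj y) = cell (μ j y) := by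
      refine (hq p).exists_lift₂ f g (fun j y => cell (μ j y)) (fun _ _ => rfl) (fun _ _ => rfl)
        (fun j y z t => ?_) (fun {j j'} k y => ?_)
      · refine (hκ j).sq_ext rfl rfl rfl rfl fun i x => ?_
        change Sq ((one f ⋆ cell ((q.proj p j).map t)) ⋆
            one ((T.F (D.obj j)).map ((κ.proj i).obj x)))
          (cell (μ j z) ⋆ one ((T.F (D.obj j)).map ((κ.proj i).obj x)))
          (cell (μ j y) ⋆ one ((T.F (D.obj j)).map ((κ.proj i).obj x)))
          ((one g ⋆ cell ((q.proj p j).map t)) ⋆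
            one ((T.F (D.obj j)).map ((κ.proj i).obj x)))
        rw [hμ, hμ, hcomp_assoc, hcomp_assoc, ← q.map, ← hcomp_assoc, ← hcomp_assoc, ← one_comp,
          ← one_comp]
        -- Compatibility of the `μ` with morphisms of `W(j)` is, after testing against `κ`, the
        -- interchange of `c i x` with the image of `t`.
        exact (Sq.interchange (cell (c i x)) (cell ((q.proj (E.obj i) j).map t))).symm
      · have eq' (f : Z ⟶ M.obj p) : f ≫ (q.proj p j').obj ((wMap W k).obj y) =
            (f ≫ (q.proj p j).obj y) ≫ T.app (D.map k) p := by
          rw [Strict.assoc]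
          congr 1
          exact one_injective ((q.one_naturality p k y).trans (one_comp _ _).symm)
        refine e₂' (eq' f) (eq' g) fun i x => ?_
        have : one (T.app (D.map k) p) ⋆ one ((T.F (D.obj j')).map ((κ.proj i).obj x)) =
          one ((T.F (D.obj j)).map ((κ.proj i).obj x)) ⋆ one (T.app (D.map k) (E.obj i)) :=
          (sD k).naturality _
        change cell (μ j' _) ⋆ one ((T.F (D.obj j')).map _) =
          (cell (μ j y) ⋆ one (T.app (D.map k) p)) ⋆ one ((T.F (D.obj j')).map _)
        rw [hμ, hcomp_assoc, this, q.one_naturality, ← hcomp_assoc, ← hcomp_assoc, hμ]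
    refine ⟨α, fun i x => e₂ rfl rfl fun j y => ?_⟩
    change (cell α ⋆ one (M.map ((κ.proj i).obj x))) ⋆ one ((q.proj (E.obj i) j).obj y) = _
    rw [hcomp_assoc, q.one_map, ← hcomp_assoc, hα, hμ]
  · intro Z f
    have eq (j : J) (y : wObj W j) (i : I) (x : wObj V i) :
        (f ≫ M.map ((κ.proj i).obj x)) ≫ (q.proj (E.obj i) j).obj y =
          (f ≫ (q.proj p j).obj y) ≫ (T.F (D.obj j)).map ((κ.proj i).obj x) := by
      apply one_injective
      rw [one_comp, one_comp, one_comp, one_comp, hcomp_assoc, hcomp_assoc, q.one_map]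
    constructor
    · intro hf i x
      exact FCategory.tight_comp hf (M.map_tight (tκ i x))
    · intro hf
      -- Tightness is tested first on the projections of `q` and then on those of `κ`. By `eq`, the
      -- resulting composites also factor through the tight 1-cells `hf i x` and the tight
      -- projections of `q`.
      refine ((hq p).isTight_iff f).2 fun j y => ((hκ j).isTight_iff _).2 fun i x => ?_
      have := FCategory.tight_comp (hf i x) (tq (E.obj i) j y)
      exact eq j _ i _ ▸ this

end Pointwise

/-! ## Creation of limits -/

namespace TransTheory

variable {o : Orientation} {w : Weakness} {S : Type v₁} [FCategory.{u} S]
  {C : Type v₂} [FCategory.{u} C] {A : Type v₃} [FCategory.{u} A] {T : TransTheory o w S C A}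

lemma osq_one_one {K : Type v} [FCategory.{u} K] {X Y : K} (x : Cell X Y) :
    OSq o (one x.src) (one x.tgt) x x := by
  cases o with
  | lax => exact (Sq.of_eq_one x).symm
  | colax => exact Sq.of_eq_one x

/-- Here the weakness imposed on tight transformations is `s`, so `tight_iff` already contains
strictness. -/
lemma isStrict_of_isTight {x y : A} {φ : x ⟶ y} (h : w = .s ∨ FCategory.IsTight φ) :
    T.IsStrict φ := by
  obtain rfl | h := h
  · exact fun _ _ f => (T.isTrans φ).is_w f
  · exact fun _ _ f => ((T.tight_iff φ).1 h).2 f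

/-- Tightness of a cone concerns only its projections at the tight part of the weight. For general
`w`, that part must be everything. -/
lemma isStrict_proj {J : Type u} [FCategory.{u} J] {W : FFunctor J BbF.{u}} {D : FFunctor J A}
    {M : A} {γ : LooseCone W D M} (tγ : γ.IsTight)
    (h : w = .s ∨ ∀ j, Function.Surjective (FullEmb.incl (W.obj j)).obj) (j : J)
    (y : wObj W j) : T.IsStrict ((γ.proj j).obj y) := by
  refine isStrict_of_isTight (h.imp_right fun h => ?_)
  obtain ⟨y, rfl⟩ := h j y
  exact tγ j y

/-- A pointwise limit cone is the image of a cone of strict transformations. -/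
lemma exists_cone {J : Type u} [FCategory.{u} J] {W : FFunctor J BbF.{u}} {D : FFunctor J A}
    (sD : ∀ {i j : J} (g : i ⟶ j), T.IsStrict (D.map g)) (x : A)
    (q : PointwiseCone T W D (T.F x)) :
    ∃ γ : LooseCone W D x, (∀ j y, T.IsStrict ((γ.proj j).obj y)) ∧
      ∀ a, γ.map (T.ev a) = q.cone a := by
  choose φ hφ nφ using fun (j : J) (y : wObj W j) => T.exists_hom (x := x) (y := D.obj j)
    (IsTrans.of_strict o w (fun {a b f g} θ => (q.map₂ θ j y).symm))
  have nφ' (j : J) (y : wObj W j) {a b : S} (f : a ⟶ b) :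
      T.nat (φ j y) f = one (T.app (φ j y) a ≫ (T.F (D.obj j)).map f) := by
    rw [nφ, hφ]
  have sφ (j : J) (y : wObj W j) : T.IsStrict (φ j y) := fun a b f => by
    rw [nφ]; exact is_one _ _
  have key (j : J) {y z : wObj W j} (t : y ⟶ z) : ∃ Γ : φ j y ⟶ φ j z, ∀ a,
      cell (T.app₂ Γ a) = cell ((q.proj a j).map t) := by
    choose p hp using fun a => (cell ((q.proj a j).map t)).exists_hom (hφ j y a).symm
      (hφ j z a).symm
    -- With identity structure 2-cells, the modification axiom is the equation `q.map`.
    obtain ⟨Γ, hΓ⟩ := T.exists_hom₂ p fun {a b} f => by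
      rw [hp, hp, q.map, ← hp, nφ', nφ']
      exact osq_one_one (cell (p a) ⋆ one ((T.F (D.obj j)).map f))
    exact ⟨Γ, fun a => by rw [hΓ, hp]⟩
  choose Γ hΓ using @key
  have e (j j' : J) (g : j ⟶ j') (y : wObj W j) :
      φ j' ((wMap W g).obj y) = φ j y ≫ D.map g := by
    have e₁ (a : S) : T.app (φ j' ((wMap W g).obj y)) a = T.app (φ j y ≫ D.map g) a := by
      rw [T.app_comp, hφ, hφ]
      exact one_injective ((q.one_naturality a g y).trans (one_comp _ _).symm)
    refine T.hom_ext e₁ fun {a b} f => ?_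
    rw [(sD g).nat_comp, nφ', e₁, nφ', T.app_comp, one_comp, one_comp, one_comp, hcomp_assoc,
      hcomp_assoc, (sD g).naturality]
  refine ⟨LooseCone.ofCell
    (fun j =>
      { obj y := φ j y
        map t := Γ j t
        map_id y := T.hom₂_ext fun a => cell_injective ?_
        map_comp t t' := T.hom₂_ext fun a => ?_ })
    (fun {j j'} g {y z} t => ext_cell (T := T) (e j j' g y) (e j j' g z) fun a => ?_)
    (fun {j j' g g'} α y => ext_cell (T := T) (e j j' g y) (e j j' g' y) fun a => ?_),
    sφ, fun a => LooseCone.ext_cell fun j y z t => hΓ j t a⟩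
  · rw [hΓ, T.app₂_id, CategoryTheory.Functor.map_id, cell_id, cell_id, hφ]
  · rw [T.app₂_comp]
    refine (VComp.cell_iff.1 ?_).symm
    rw [hΓ, hΓ, hΓ, CategoryTheory.Functor.map_comp]
    exact .mk _ _
  · rw [FFunctor.mapCell_hcomp, FFunctor.mapCell_one]
    refine (hΓ j' _ a).trans ((q.cell_naturality a g t).trans ?_)
    rw [← hΓ]
    rfl
  · rw [FFunctor.mapCell_hcomp, FFunctor.mapCell_one]
    refine (hΓ j' _ a).trans ((q.cell_naturality₂ a α y).trans ?_)
    rw [← hφ]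
    rfl

/-- Creation of limits by the evaluations of an `ℱ`-category of models. -/
theorem isCreated (T : TransTheory o w S C A) {Ψ : Set Weight.{u}}
    (hΨ : w = .s ∨ ∀ Φ ∈ Ψ, Φ.IsTight) (hC : IsComplete Ψ C)
    (cones : Set (WeightedCone.{u, v₁} S))
    (isModel : ∀ x, ∀ κ ∈ cones, (κ.cone.map (T.F x)).IsLimit)
    (exists_model : ∀ M : FFunctor S C, (∀ κ ∈ cones, (κ.cone.map M).IsLimit) →
      ∃ x, T.F x = M) :
    IsComplete Ψ A ∧ (∀ a, PreservesLimits Ψ (T.ev a)) ∧ JointlyReflectLimits Ψ T.ev := by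
  -- A tight weight has chordate indexing `ℱ`-category, so `D.map g` is tight and hence strict.
  have sD {Φ : Weight.{u}} (hΦ : Φ ∈ Ψ) (D : FFunctor Φ.J A) {i j : Φ.J} (g : i ⟶ j) :
      T.IsStrict (D.map g) :=
    isStrict_of_isTight (hΨ.imp_right fun h => D.map_tight ((h Φ hΦ).1 g))
  have sur {Φ : Weight.{u}} (hΦ : Φ ∈ Ψ) : w = .s ∨
      ∀ j, Function.Surjective (FullEmb.incl (Φ.W.obj j)).obj :=
    hΨ.imp_right fun h => (h Φ hΦ).2
  have key {Φ : Weight.{u}} (hΦ : Φ ∈ Ψ) (D : FFunctor Φ.J A) :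
      ∃ (x : A) (γ : LooseCone Φ.W D x), γ.IsTight ∧ γ.IsLimit ∧
        ∀ a, (γ.map (T.ev a)).IsLimit := by
    choose X γ tγ hγ using fun a => hC Φ hΦ (D.comp (T.ev a))
    obtain ⟨M, q, hq⟩ := exists_pointwiseCone (sD hΦ D) X γ tγ hγ
    obtain ⟨x, rfl⟩ := exists_model M fun κ hκ => q.isLimit_map (sD hΦ D) (fun a => (hq a).1)
      (fun a => (hq a).2) κ.cone κ.tight fun j => isModel _ κ hκ
    obtain ⟨δ, sδ, hδ⟩ := exists_cone (sD hΦ D) x q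
    have hδ' (a : S) : (δ.map (T.ev a)).IsLimit := by
      rw [hδ]; exact (hq a).2
    refine ⟨x, δ, fun j y => (T.tight_iff _).2 ⟨fun a => ?_, fun {a b} f => sδ j _ f⟩,
      isLimit_of_ev δ (sD hΦ D) sδ (sur hΦ) hδ', hδ'⟩
    have h₁ : (δ.map (T.ev a)).IsTight := by
      rw [hδ]; exact (hq a).1
    exact h₁ j y
  refine ⟨fun Φ hΦ D => ?_, fun a κ hκ hl => ?_, fun κ hκ h => ?_⟩
  · obtain ⟨x, γ, tγ, hγ, -⟩ := key hΦ D
    exact ⟨x, γ, tγ, hγ⟩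
  -- A given limit cone need not be the pointwise one, but it is isomorphic to the one supplied by
  -- `key`, which the evaluations preserve.
  · obtain ⟨x, γ, tγ, hγ, hγ'⟩ := key hκ κ.D
    exact hγ.map_of_isLimit tγ hl κ.tight _ (hγ' a)
  · exact isLimit_of_ev κ.cone (sD hκ κ.D) (isStrict_proj κ.tight (sur hκ)) (sur hκ) h

end TransTheory

/-! ## Lax and colax transformations -/

/-- The shape taken by the composition laws of lax and oplax transformations once the associators
are `eqToHom`s: the middle transport matches the boundaries and the last is absorbed. -/
lemma Cell.vcomp_cell_comp {K : Type v} [FCategory.{u} K] {X Y : K} {f g g' h h' : X ⟶ Y}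
    (α : f ⟶ g) (p : g = g') (β : g' ⟶ h) (q : h = h') :
    VComp (cell α) (cell β) (cell (α ≫ eqToHom p ≫ β ≫ eqToHom q)) := by
  subst p q
  rw [eqToHom_refl, eqToHom_refl, Category.id_comp, Category.comp_id]
  exact .mk _ _

section Instances

variable {S : Type u} [FCategory.{u} S] {C : Type v₁} [FCategory.{u} C] {X : Type v₂}

/-! ### The lax orientation, which serves `w = s`, `p` and `l`. -/

namespace LaxAux

open scoped Lax.LaxTrans Lax.LaxTrans.LaxFunctor

/-- The comparison 2-cells of an `ℱ`-functor, like associators and unitors, are `eqToHom`s. On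
bundled cells they vanish from the axioms of a lax transformation. -/
lemma isTrans {w : Weakness} {M N : FFunctor S C} (φ : Lax.LaxTrans M.toLaxFunctor N.toLaxFunctor)
    (h : ∀ {a b : S} (f : a ⟶ b), w.IsCell (φ.naturality f))
    (h' : ∀ {a b : S} (f : a ⟶ b), FCategory.IsTight f → Weakness.s.IsCell (φ.naturality f)) :
    IsTrans .lax w M N φ.app (fun f => cell (φ.naturality f)) where
  bd f := ⟨rfl, rfl⟩
  naturality θ := by
    have := Sq.cell_iff.2 (φ.naturality_naturality θ)
    rw [cell_whiskerLeft, cell_whiskerRight] at this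
    exact this
  id a := by
    have := congrArg cell (φ.naturality_id a)
    rw [M.mapId_eq, N.mapId_eq, whiskerLeft_eqToHom, cell_eqToHom_comp, eqToHom_whiskerRight,
      Strict.leftUnitor_eqToIso, Strict.rightUnitor_eqToIso, eqToIso.hom, eqToIso.inv,
      cell_eqToHom_comp, cell_eqToHom_comp, cell_eqToHom] at this
    rw [this, Strict.id_comp]
  comp {a b c} f g := by
    have := congrArg cell (φ.naturality_comp f g)
    rw [M.mapComp_eq, N.mapComp_eq, whiskerLeft_eqToHom, cell_eqToHom_comp,
      eqToHom_whiskerRight, Strict.associator_eqToIso, Strict.associator_eqToIso,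
      Strict.associator_eqToIso, eqToIso.inv, eqToIso.hom, eqToIso.inv, cell_eqToHom_comp,
      eqToHom_trans] at this
    rw [← cell_whiskerLeft, ← cell_whiskerRight, this]
    exact vcomp_cell_comp _ _ _ _
  is_w f := h f
  is_s f hf := h' f hf

lemma exists_trans {w : Weakness} {M N : FFunctor S C} {p : ∀ a, M.obj a ⟶ N.obj a}
    {n : ∀ {a b : S}, (a ⟶ b) → Cell (M.obj a) (N.obj b)} (h : IsTrans .lax w M N p n) :
    ∃ φ : Lax.LaxTrans M.toLaxFunctor N.toLaxFunctor, φ.app = p ∧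
      ∀ {a b : S} (f : a ⟶ b), cell (φ.naturality f) = n f := by
  choose α hα using fun {a b : S} (f : a ⟶ b) => (n f).exists_hom (h.bd f).1 (h.bd f).2
  refine ⟨Lax.LaxTrans.mk p α (fun {a b f g} θ => ?_) (fun a => ?_)
    (fun {a b c} f g => ?_), rfl, @hα⟩
  · rw [← Sq.cell_iff, cell_whiskerLeft, cell_whiskerRight, hα, hα]
    exact h.naturality θ
  · apply cell_injective
    rw [M.mapId_eq, N.mapId_eq, whiskerLeft_eqToHom, cell_eqToHom_comp, eqToHom_whiskerRight,
      Strict.leftUnitor_eqToIso, Strict.rightUnitor_eqToIso, eqToIso.hom, eqToIso.inv,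
      cell_eqToHom_comp, cell_eqToHom_comp, cell_eqToHom, hα, h.id, Strict.id_comp]
  · apply cell_injective
    rw [M.mapComp_eq, N.mapComp_eq, whiskerLeft_eqToHom, cell_eqToHom_comp,
      eqToHom_whiskerRight, Strict.associator_eqToIso, Strict.associator_eqToIso,
      Strict.associator_eqToIso, eqToIso.inv, eqToIso.hom, eqToIso.inv, cell_eqToHom_comp,
      eqToHom_trans, hα]
    have h₁ := h.comp f g
    rw [← hα f, ← hα g, ← cell_whiskerLeft, ← cell_whiskerRight] at h₁
    exact VComp.unique h₁ (vcomp_cell_comp _ _ _ _)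

lemma trans_ext {M N : FFunctor S C} {φ ψ : Lax.LaxTrans M.toLaxFunctor N.toLaxFunctor}
    (h : ∀ a, φ.app a = ψ.app a)
    (h' : ∀ {a b : S} (f : a ⟶ b), cell (φ.naturality f) = cell (ψ.naturality f)) : φ = ψ := by
  cases φ with | mk p n _ _ _ =>
  cases ψ with | mk p' n' _ _ _ =>
  obtain rfl : p = p' := funext h
  have : @n = @n' := by
    funext a b f
    exact cell_injective (h' f)
  subst this; rfl

lemma comp_nat {M N P : S ⥤ᴸ C} (φ : Lax.LaxTrans M N) (ψ : Lax.LaxTrans N P) {a b : S}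
    (f : a ⟶ b) : OComp .lax (one (φ.app a) ⋆ cell (ψ.naturality f))
      (cell (φ.naturality f) ⋆ one (ψ.app b)) (cell (φ.vCompNaturality ψ f)) := by
  unfold Lax.LaxTrans.vCompNaturality
  rw [Strict.associator_eqToIso, Strict.associator_eqToIso, Strict.associator_eqToIso,
    eqToIso.inv, eqToIso.hom, eqToIso.hom, cell_eqToHom_comp, ← cell_whiskerLeft,
    ← cell_whiskerRight]
  exact vcomp_cell_comp _ _ _ _

/-- The `ℱ`-categories of lax transformations. -/
def transTheory (w : Weakness) (obj : X → FFunctor S C) :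
    TransTheory .lax w S C (cells .s w obj).Obj where
  F := obj
  app φ a := φ.hom.app a
  nat {_ _} φ {_ _} f := cell (φ.hom.naturality f)
  app₂ Γ a := Γ.cell.as.app a
  app_id _ _ := rfl
  app_comp _ _ _ := rfl
  app₂_id _ _ := rfl
  app₂_comp _ _ _ := rfl
  app₂_whiskerLeft _ _ _ _ _ := cell_whiskerLeft _ _
  app₂_whiskerRight _ _ _ := cell_whiskerRight _ _
  isTrans φ := isTrans φ.hom φ.mem.1 φ.mem.2
  hom_ext h h' := OneCells.hom_ext (trans_ext h h')
  exists_hom {x y p n} h := by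
    obtain ⟨φ, rfl, hφ⟩ := exists_trans h
    refine ⟨⟨φ, fun {a b} f => ?_, fun {a b} f hf => ?_⟩, fun _ => rfl, hφ⟩
    · have := h.is_w f
      rw [← hφ] at this
      exact this
    · have := h.is_s f hf
      rw [← hφ] at this
      exact this
  isMod {_ _ _ _} Γ {_ _} f := by
    have := (Sq.cell_iff.2 (Γ.cell.as.naturality f)).symm
    rw [cell_whiskerLeft, cell_whiskerRight] at this
    exact this
  hom₂_ext h := by
    refine OneCells.hom₂_ext ?_
    ext a
    exact h a
  exists_hom₂ {_ _ _ _} p h := by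
    refine ⟨⟨⟨⟨p, fun {a b} f => ?_⟩⟩⟩, fun _ => rfl⟩
    refine Sq.cell_iff.1 ?_
    rw [cell_whiskerLeft, cell_whiskerRight]
    exact Sq.symm (h f)
  nat_comp φ ψ _ _ f := comp_nat φ.hom ψ.hom f
  tight_iff φ := Iff.rfl

end LaxAux

/-! ### The colax orientation, which serves `w = c`. -/

namespace OplaxAux

open scoped Lax.OplaxTrans Lax.OplaxTrans.LaxFunctor

lemma isTrans {w : Weakness} {M N : FFunctor S C}
    (φ : Lax.OplaxTrans M.toLaxFunctor N.toLaxFunctor)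
    (h : ∀ {a b : S} (f : a ⟶ b), w.IsCell (φ.naturality f))
    (h' : ∀ {a b : S} (f : a ⟶ b), FCategory.IsTight f → Weakness.s.IsCell (φ.naturality f)) :
    IsTrans .colax w M N φ.app (fun f => cell (φ.naturality f)) where
  bd f := ⟨rfl, rfl⟩
  naturality θ := by
    have := Sq.cell_iff.2 (φ.naturality_naturality θ)
    rw [cell_whiskerLeft, cell_whiskerRight] at this
    exact this
  id a := by
    have := congrArg cell (φ.naturality_id a)
    rw [M.mapId_eq, N.mapId_eq, whiskerLeft_eqToHom, eqToHom_whiskerRight, cell_eqToHom_comp,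
      Strict.leftUnitor_eqToIso, Strict.rightUnitor_eqToIso, eqToIso.hom, eqToIso.inv,
      cell_eqToHom_comp, cell_eqToHom_comp, cell_eqToHom] at this
    rw [this, Strict.comp_id]
  comp {a b c} f g := by
    have := congrArg cell (φ.naturality_comp f g)
    rw [M.mapComp_eq, N.mapComp_eq, eqToHom_whiskerRight, cell_eqToHom_comp,
      whiskerLeft_eqToHom, Strict.associator_eqToIso, Strict.associator_eqToIso,
      Strict.associator_eqToIso, eqToIso.inv, eqToIso.hom, eqToIso.hom, cell_eqToHom_comp,
      eqToHom_trans] at this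
    rw [← cell_whiskerLeft, ← cell_whiskerRight, this]
    exact vcomp_cell_comp _ _ _ _
  is_w f := h f
  is_s f hf := h' f hf

lemma exists_trans {w : Weakness} {M N : FFunctor S C} {p : ∀ a, M.obj a ⟶ N.obj a}
    {n : ∀ {a b : S}, (a ⟶ b) → Cell (M.obj a) (N.obj b)} (h : IsTrans .colax w M N p n) :
    ∃ φ : Lax.OplaxTrans M.toLaxFunctor N.toLaxFunctor, φ.app = p ∧
      ∀ {a b : S} (f : a ⟶ b), cell (φ.naturality f) = n f := by
  choose α hα using fun {a b : S} (f : a ⟶ b) => (n f).exists_hom (h.bd f).1 (h.bd f).2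
  refine ⟨Lax.OplaxTrans.mk p α (fun {a b f g} θ => ?_) (fun a => ?_)
    (fun {a b c} f g => ?_), rfl, @hα⟩
  · rw [← Sq.cell_iff, cell_whiskerLeft, cell_whiskerRight, hα, hα]
    exact h.naturality θ
  · apply cell_injective
    rw [M.mapId_eq, N.mapId_eq, whiskerLeft_eqToHom, eqToHom_whiskerRight, cell_eqToHom_comp,
      Strict.leftUnitor_eqToIso, Strict.rightUnitor_eqToIso, eqToIso.hom, eqToIso.inv,
      cell_eqToHom_comp, cell_eqToHom_comp, cell_eqToHom, hα, h.id, Strict.comp_id]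
  · apply cell_injective
    rw [M.mapComp_eq, N.mapComp_eq, eqToHom_whiskerRight, cell_eqToHom_comp,
      whiskerLeft_eqToHom, Strict.associator_eqToIso, Strict.associator_eqToIso,
      Strict.associator_eqToIso, eqToIso.inv, eqToIso.hom, eqToIso.hom, cell_eqToHom_comp,
      eqToHom_trans, hα]
    have h₁ := h.comp f g
    rw [← hα f, ← hα g, ← cell_whiskerLeft, ← cell_whiskerRight] at h₁
    exact VComp.unique h₁ (vcomp_cell_comp _ _ _ _)

lemma trans_ext {M N : FFunctor S C} {φ ψ : Lax.OplaxTrans M.toLaxFunctor N.toLaxFunctor}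
    (h : ∀ a, φ.app a = ψ.app a)
    (h' : ∀ {a b : S} (f : a ⟶ b), cell (φ.naturality f) = cell (ψ.naturality f)) : φ = ψ := by
  cases φ with | mk p n _ _ _ =>
  cases ψ with | mk p' n' _ _ _ =>
  obtain rfl : p = p' := funext h
  have : @n = @n' := by
    funext a b f
    exact cell_injective (h' f)
  subst this; rfl

lemma comp_nat {M N P : S ⥤ᴸ C} (φ : Lax.OplaxTrans M N) (ψ : Lax.OplaxTrans N P) {a b : S}
    (f : a ⟶ b) : OComp .colax (one (φ.app a) ⋆ cell (ψ.naturality f))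
      (cell (φ.naturality f) ⋆ one (ψ.app b)) (cell (φ.vCompNaturality ψ f)) := by
  unfold Lax.OplaxTrans.vCompNaturality
  rw [Strict.associator_eqToIso, Strict.associator_eqToIso, Strict.associator_eqToIso,
    eqToIso.inv, eqToIso.hom, eqToIso.inv, cell_eqToHom_comp, ← cell_whiskerLeft,
    ← cell_whiskerRight]
  exact vcomp_cell_comp _ _ _ _

/-- The `ℱ`-categories of colax transformations. -/
def transTheory (w : Weakness) (obj : X → FFunctor S C) :
    TransTheory .colax w S C (cells .s w obj).Obj where
  F := obj
  app φ a := φ.hom.app a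
  nat {_ _} φ {_ _} f := cell (φ.hom.naturality f)
  app₂ Γ a := Γ.cell.as.app a
  app_id _ _ := rfl
  app_comp _ _ _ := rfl
  app₂_id _ _ := rfl
  app₂_comp _ _ _ := rfl
  app₂_whiskerLeft _ _ _ _ _ := cell_whiskerLeft _ _
  app₂_whiskerRight _ _ _ := cell_whiskerRight _ _
  isTrans φ := isTrans φ.hom φ.mem.1 φ.mem.2
  hom_ext h h' := OneCells.hom_ext (trans_ext h h')
  exists_hom {x y p n} h := by
    obtain ⟨φ, rfl, hφ⟩ := exists_trans h
    refine ⟨⟨φ, fun {a b} f => ?_, fun {a b} f hf => ?_⟩, fun _ => rfl, hφ⟩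
    · have := h.is_w f
      rw [← hφ] at this
      exact this
    · have := h.is_s f hf
      rw [← hφ] at this
      exact this
  isMod {_ _ _ _} Γ {_ _} f := by
    have := Sq.cell_iff.2 (Γ.cell.as.naturality f)
    rw [cell_whiskerLeft, cell_whiskerRight] at this
    exact this
  hom₂_ext h := by
    refine OneCells.hom₂_ext ?_
    ext a
    exact h a
  exists_hom₂ {_ _ _ _} p h := by
    refine ⟨⟨⟨⟨p, fun {a b} f => ?_⟩⟩⟩, fun _ => rfl⟩
    refine Sq.cell_iff.1 ?_
    rw [cell_whiskerLeft, cell_whiskerRight]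
    exact h f
  nat_comp φ ψ _ _ f := comp_nat φ.hom ψ.hom f
  tight_iff φ := Iff.rfl

end OplaxAux

end Instances

/-- A class of `ℱ`-weights is `(s, w)`-created if `w = s` or if it consists of tight weights. -/
theorem isCreated_of_eq_or_isTight {w : Weakness} {Ψ : Set Weight.{u}}
    (hΨ : w = .s ∨ ∀ Φ ∈ Ψ, Φ.IsTight) : IsCreated.{u, v} .s w Ψ := by
  intro 𝒮 C _ _ hC
  -- In each case below, the evaluations `T.ev` of the presentation agree with `FunOn.eval` by
  -- definition.
  have lax (w : Weakness) (hΨ : w = .s ∨ ∀ Φ ∈ Ψ, Φ.IsTight) :=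
    (LaxAux.transTheory w (fun M : Model 𝒮 (.ofFCategory C) => M.1)).isCreated hΨ hC 𝒮.cones
      (fun x κ hκ => x.2 κ hκ) (fun M hM => ⟨⟨M, hM⟩, rfl⟩)
  have colax :=
    (OplaxAux.transTheory w (fun M : Model 𝒮 (.ofFCategory C) => M.1)).isCreated hΨ hC 𝒮.cones
      (fun x κ hκ => x.2 κ hκ) (fun M hM => ⟨⟨M, hM⟩, rfl⟩)
  cases w with
  | s => exact lax .s hΨ
  | p => exact lax .p hΨ
  | l => exact lax .l hΨ
  | c => exact colax

end Enhanced

theorem mainTheorem3 :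
    (∀ Ψ : Set Enhanced.Weight.{u}, Enhanced.IsCreated.{u, v} .s .s Ψ) ∧
    (∀ Ψ : Set Enhanced.Weight.{u}, (∀ Φ ∈ Ψ, Φ.IsTight) →
      ∀ w : Enhanced.Weakness, Enhanced.IsCreated.{u, v} .s w Ψ) := by
  exact ⟨fun _ => Enhanced.isCreated_of_eq_or_isTight (.inl rfl),
    fun _ h _ => Enhanced.isCreated_of_eq_or_isTight (.inr h)⟩
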